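/- Let $S$ be a nonempty geodesic metric space that is Gromov hyperbolic, with Gromov boundary $\partial S$, and let $\Gamma$ be a group acting on $S$ by isometries. An element $h\in\Gamma$ is *loxodromic* if each orbit map $\mathbb Z\to S$, $i\mapsto h^i x$, is a quasi-isometric embedding; it then has a repelling and an attracting endpoint $\partial_-h\neq\partial_+h$ in $\partial S$, the limits of $h^{-n}x$ and $h^{n}x$ as $n\to+\infty$ (for any $x\in S$). Two loxodromic elements $g,h$ are *independent* if $\{\partial_-g,\partial_+g\}\cap\{\partial_-h,\partial_+h\}=\emptyset$. Write $\mathrm{Stab}(\partial_\pm h)=\{g\in\Gamma: g\,\partial_-h=\partial_-h,\ g\,\partial_+h=\partial_+h\}$. An element $h\in\Gamma$ is *WWPD* if it is loxodromic and for every $x\in S$ and $R>0$ there is an integer $M\ge 1$ such that every subset $Z\subset\Gamma$ with the following two properties is finite: (1) $d(x,gx)<R$ and $d(h^Mx,gh^Mx)<R$ for all $g\in Z$; (2) no two elements of $Z$ lie in the same left coset of $\mathrm{Stab}(\partial_\pm h)$. Let $H^2_b(\Gamma;\mathbb R)$ be the second bounded cohomology of $\Gamma$, i.e. the bounded functions $c\colon\Gamma\times\Gamma\to\mathbb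 R$ with $c(h,k)-c(gh,k)+c(g,hk)-c(g,h)=0$ for all $g,h,k$, modulo those of the form $c(g,h)=f(g)+f(h)-f(gh)$ with $f\colon\Gamma\to\mathbb R$ bounded, with the seminorm induced by the sup norm. **Theorem.** If $\Gamma$ contains an independent pair of loxodromic elements and $\Gamma$ contains a WWPD element, then $H^2_b(\Gamma;\mathbb R)$ contains an embedded $\ell^1$: there is an injective bounded $\mathbb R$-linear map $\ell^1\to H^2_b(\Gamma;\mathbb R)$, where $\ell^1$ is the space of absolutely summable real sequences. -/

import Mathlib

open Filter Topology
open scoped ENNReal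

/-! ## Geodesic and Gromov hyperbolic metric spaces -/

/-- A metric space in which any two points are joined by a geodesic segment. -/
class GeodesicMetricSpace (X : Type*) [MetricSpace X] : Prop where
  exists_geodesic : ∀ x y : X, ∃ γ : ℝ → X, γ 0 = x ∧ γ (dist x y) = y ∧
    ∀ s ∈ Set.Icc (0 : ℝ) (dist x y), ∀ t ∈ Set.Icc (0 : ℝ) (dist x y),
      dist (γ s) (γ t) = |s - t|

/-- The Gromov product `(x | y)_o`. -/
noncomputable def gromovProduct {X : Type*} [MetricSpace X] (o x y : X) : ℝ :=
  (dist x o + dist y o - dist x y) / 2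

/-- Gromov hyperbolicity, in terms of the Gromov product (the four-point condition). -/
class GromovHyperbolicSpace (X : Type*) [MetricSpace X] : Prop where
  exists_delta : ∃ δ : ℝ, ∀ o x y z : X,
    min (gromovProduct o x y) (gromovProduct o y z) - δ ≤ gromovProduct o x z

/-! ## The Gromov boundary -/

/-- The sequence `u` converges to infinity: `(u m | u n)_o → ∞` as `m, n → ∞`. -/
def IsGromovSequence {X : Type*} [MetricSpace X] (u : ℕ → X) : Prop :=
  ∀ o : X, Tendsto (fun p : ℕ × ℕ => gromovProduct o (u p.1) (u p.2)) atTop atTop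

/-- Two sequences converging to infinity are equivalent if `(u n | v n)_o → ∞`. -/
def GromovSequenceEquiv {X : Type*} [MetricSpace X] (u v : ℕ → X) : Prop :=
  ∀ o : X, Tendsto (fun n : ℕ => gromovProduct o (u n) (v n)) atTop atTop

/-- The equivalence relation on sequences converging to infinity. -/
instance gromovSequenceSetoid (X : Type*) [MetricSpace X] [GromovHyperbolicSpace X] :
    Setoid {u : ℕ → X // IsGromovSequence u} where
  r u v := GromovSequenceEquiv u.1 v.1
  iseqv :=
    { refl := fun u o => (u.2 o).comp
        (tendsto_atTop_diagonal : Tendsto (fun n : ℕ => (n, n)) atTop atTop)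
      symm := by
        intro u v h o
        refine (h o).congr fun n => ?_
        simp only [gromovProduct, dist_comm (u.1 n) (v.1 n)]
        ring
      trans := by
        intro u v w huv hvw o
        obtain ⟨δ, hδ⟩ := GromovHyperbolicSpace.exists_delta (X := X)
        refine tendsto_atTop.2 fun b => ?_
        filter_upwards [tendsto_atTop.1 (huv o) (b + δ), tendsto_atTop.1 (hvw o) (b + δ)]
          with n h1 h2
        have h3 := hδ o (u.1 n) (v.1 n) (w.1 n)
        have h4 := le_min h1 h2
        linarith }

/-- The Gromov boundary `∂X`: equivalence classes of sequences converging to infinity. -/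
def GromovBoundary (X : Type*) [MetricSpace X] [GromovHyperbolicSpace X] : Type _ :=
  Quotient (gromovSequenceSetoid X)

/-- The sequence `u` of points of `X` converges to the boundary point `ξ`. -/
def ConvergesToBoundary {X : Type*} [MetricSpace X] [GromovHyperbolicSpace X]
    (u : ℕ → X) (ξ : GromovBoundary X) : Prop :=
  ∃ hu : IsGromovSequence u, (Quotient.mk (gromovSequenceSetoid X) ⟨u, hu⟩) = ξ

section Action

variable {Γ : Type*} [Group Γ] {X : Type*} [MetricSpace X] [MulAction Γ X] [IsIsometricSMul Γ X]

theorem gromovProduct_smul (g : Γ) (o x y : X) :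
    gromovProduct o (g • x) (g • y) = gromovProduct (g⁻¹ • o) x y := by
  have h (z : X) : dist (g • z) o = dist z (g⁻¹ • o) := by
    rw [← dist_smul g z (g⁻¹ • o), smul_inv_smul]
  simp only [gromovProduct, h, dist_smul]

theorem IsGromovSequence.smul {u : ℕ → X} (hu : IsGromovSequence u) (g : Γ) :
    IsGromovSequence (fun n => g • u n) := by
  intro o
  simpa only [gromovProduct_smul] using hu (g⁻¹ • o)

variable [GromovHyperbolicSpace X]

/-- The action on the boundary induced by an isometric action: `g • [u] = [g • u]`. -/
instance gromovBoundaryMulAction : MulAction Γ (GromovBoundary X) where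
  smul g := Quotient.map (fun u => ⟨fun n => g • u.1 n, u.2.smul g⟩) (by
    intro u v h o
    simpa only [gromovProduct_smul] using h (g⁻¹ • o))
  one_smul := by
    rintro ⟨u⟩
    exact congrArg (Quotient.mk _) (Subtype.ext (funext fun n => one_smul Γ (u.1 n)))
  mul_smul := by
    rintro g h ⟨u⟩
    exact congrArg (Quotient.mk _) (Subtype.ext (funext fun n => mul_smul g h (u.1 n)))

end Action

/-! ## Loxodromic elements, independence, WWPD -/

section WWPD

variable {Γ : Type*} [Group Γ] (X : Type*) [MetricSpace X] [MulAction Γ X]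

/-- `h` acts loxodromically on `X`: each orbit map `i ↦ h ^ i • x` is a quasi-isometric
embedding of `ℤ` into `X`. -/
def IsLoxodromic (h : Γ) : Prop :=
  ∀ x : X, ∃ K C : ℝ, 1 ≤ K ∧ 0 ≤ C ∧ ∀ m n : ℤ,
    |(m : ℝ) - n| / K - C ≤ dist (h ^ m • x) (h ^ n • x) ∧
      dist (h ^ m • x) (h ^ n • x) ≤ K * |(m : ℝ) - n| + C

variable [GromovHyperbolicSpace X]

/-- `ξ` is the attracting endpoint `∂₊h`: `h ^ n • x → ξ` for `n → +∞` and all `x`. -/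
def IsAttractor (h : Γ) (ξ : GromovBoundary X) : Prop :=
  ∀ x : X, ConvergesToBoundary (fun n : ℕ => h ^ n • x) ξ

/-- `ξ` is the repelling endpoint `∂₋h`: `h ^ (-n) • x → ξ` for `n → +∞` and all `x`. -/
def IsRepeller (h : Γ) (ξ : GromovBoundary X) : Prop :=
  ∀ x : X, ConvergesToBoundary (fun n : ℕ => h⁻¹ ^ n • x) ξ

/-- The set `∂h = {∂₋h, ∂₊h}` of endpoints of `h`. -/
def boundaryEndpoints (h : Γ) : Set (GromovBoundary X) :=
  {ξ | IsRepeller X h ξ ∨ IsAttractor X h ξ}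

/-- `g` and `h` are independent loxodromic elements. -/
def IndependentLoxodromics (g h : Γ) : Prop :=
  IsLoxodromic X g ∧ IsLoxodromic X h ∧
    Disjoint (boundaryEndpoints X g) (boundaryEndpoints X h)

variable [IsIsometricSMul Γ X]

/-- The stabilizer of the ordered pair `(∂₋h, ∂₊h)`, i.e. the elements that fix both `∂₋h`
and `∂₊h`. -/
def endpointStabilizer (h : Γ) : Subgroup Γ :=
  fixingSubgroup Γ (boundaryEndpoints X h)

/-- `h` is a WWPD element of the action of `Γ` on `X`. The condition `Set.InjOn` says that no two
elements of `Z` lie in the same left coset of the stabilizer of `(∂₋h, ∂₊h)`. -/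
def IsWWPD (h : Γ) : Prop :=
  IsLoxodromic X h ∧ ∀ x : X, ∀ R : ℝ, 0 < R → ∃ M : ℕ, 1 ≤ M ∧ ∀ Z : Set Γ,
    (∀ g ∈ Z, dist x (g • x) < R ∧ dist (h ^ M • x) (g • h ^ M • x) < R) →
    Set.InjOn (fun g : Γ => (g : Γ ⧸ endpointStabilizer X h)) Z →
    Z.Finite

end WWPD

/-! ## Second bounded cohomology with trivial real coefficients -/

section BoundedCohomology

variable (Γ : Type*) [Group Γ]

/-- Bounded inhomogeneous 1-cochains `Γ → ℝ`, with the sup norm. -/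
abbrev BoundedOneCochain : Type _ := lp (fun _ : Γ => ℝ) ∞

/-- Bounded inhomogeneous 2-cochains `Γ × Γ → ℝ`, with the sup norm. -/
abbrev BoundedTwoCochain : Type _ := lp (fun _ : Γ × Γ => ℝ) ∞

/-- The bounded 2-cocycles: `δc (g, h, k) = c (h, k) - c (g h, k) + c (g, h k) - c (g, h) = 0`. -/
def boundedTwoCocycles : Submodule ℝ (BoundedTwoCochain Γ) where
  carrier := {c | ∀ g h k : Γ, c (h, k) - c (g * h, k) + c (g, h * k) - c (g, h) = 0}
  zero_mem' := by intro g h k; simp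
  add_mem' := by
    intro a b ha hb g h k
    have h1 := ha g h k
    have h2 := hb g h k
    simp only [lp.coeFn_add, Pi.add_apply]
    linarith
  smul_mem' := by
    intro r a ha g h k
    have h1 := ha g h k
    simp only [lp.coeFn_smul, Pi.smul_apply, smul_eq_mul]
    linear_combination r * h1

/-- The coboundaries `δf (g, h) = f g + f h - f (g h)` of bounded 1-cochains `f`. -/
def boundedTwoCoboundaries : Submodule ℝ (BoundedTwoCochain Γ) where
  carrier := {c | ∃ f : BoundedOneCochain Γ, ∀ g h : Γ, c (g, h) = f g + f h - f (g * h)}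
  zero_mem' := ⟨0, by simp⟩
  add_mem' := by
    rintro a b ⟨f, hf⟩ ⟨f', hf'⟩
    refine ⟨f + f', fun g h => ?_⟩
    simp only [lp.coeFn_add, Pi.add_apply, hf, hf']
    ring
  smul_mem' := by
    rintro r a ⟨f, hf⟩
    refine ⟨r • f, fun g h => ?_⟩
    simp only [lp.coeFn_smul, Pi.smul_apply, smul_eq_mul, hf]
    ring

theorem boundedTwoCoboundaries_le : boundedTwoCoboundaries Γ ≤ boundedTwoCocycles Γ := by
  rintro c ⟨f, hf⟩ g h k
  simp only [hf, mul_assoc]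
  ring

/-- The second bounded cohomology `H²_b(Γ; ℝ)`: bounded 2-cocycles modulo coboundaries of bounded
1-cochains, with the quotient seminorm. -/
abbrev SecondBoundedCohomology : Type _ :=
  boundedTwoCocycles Γ ⧸ (boundedTwoCoboundaries Γ).submoduleOf (boundedTwoCocycles Γ)

end BoundedCohomology

/-! The embedded ℓ¹ comes from a sequence of quasimorphisms with one common defect bound, in the
spirit of the counting quasimorphisms of Brooks, Epstein and Fujiwara.

For `u` in `Γ`, add to the space directed shortcuts from `g • x` to `g • u • x`, for all `g`, each
saving a fixed amount `W`. This gives an invariant asymmetric distance, `shortcutDist`, and the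
quasimorphism f(g) = d(x, gx) - d(gx, x). Nearly optimal paths for d stay close to geodesics, by a
Morse-type argument whose constants involve only δ and `W`
(`IsTightChain.exists_step_near_of_between`). So d is additive along geodesics up to a constant, and
cutting a triangle at its centre bounds the defect independently of `u`
(`exists_shortcutForm_cocycle_bound`).

The hypotheses on the action serve to find good words. Let `h` be WWPD. Two translates of its axis
with a long overlap are coarsely equal (`IsWWPD.exists_mem_axisStabilizer_of_overlap`), and the
independent pair yields a `t` that moves the axis off itself. Then u = h^N t h^(4N) t⁻¹ h^(-7N) t
h^(2N) t⁻¹ has a quasigeodesic axis, and a translate of an `h`-segment that runs along this axis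
cannot continue past a turn (`IsQuasiAxis.exists_no_turn_inside`). Hence the cyclic pattern 1, 4, 7,
2 of piece lengths can be read off geometrically. It distinguishes the axis from its reverse, and a
period with much longer pieces does not fit along it.

With N growing along a sequence this gives words u n and quasimorphisms f n such that f n (u n ^ k)
≤ -k + 1, while f m is bounded by 1 on the powers of u n for m > n. The exponents of `h`, and those
of `t`, sum to 0, so every homomorphism to ℝ kills u n. If ∑ a n • δ(f n) is the coboundary of a
bounded b, then ∑ a n • f n - b is a homomorphism. Evaluating it on the powers of u n, for the least
n with a n ≠ 0, gives a contradiction (`IsTriangularFamily.eq_zero_of_tsum_eq`). -/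

/-! ## Elementary hyperbolic geometry -/

section Hyperbolic

variable {X : Type*} [MetricSpace X]

/-- The four-point condition with a given constant. -/
def IsHyperbolicWith (X : Type*) [MetricSpace X] (δ : ℝ) : Prop :=
  ∀ o x y z : X, min (gromovProduct o x y) (gromovProduct o y z) - δ ≤ gromovProduct o x z

theorem exists_isHyperbolicWith (X : Type*) [MetricSpace X] [GromovHyperbolicSpace X] :
    ∃ δ : ℝ, 1 ≤ δ ∧ IsHyperbolicWith X δ := by
  obtain ⟨δ, hδ⟩ := GromovHyperbolicSpace.exists_delta (X := X)
  refine ⟨max δ 1, le_max_right _ _, fun o x y z => ?_⟩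
  have := hδ o x y z
  have := le_max_left δ 1
  linarith

theorem gromovProduct_comm (o x y : X) : gromovProduct o x y = gromovProduct o y x := by
  simp only [gromovProduct, dist_comm x y]; ring

theorem gromovProduct_nonneg (o x y : X) : 0 ≤ gromovProduct o x y := by
  have := dist_triangle x o y
  simp only [gromovProduct, dist_comm y o]; linarith

theorem gromovProduct_le_dist_left (o x y : X) : gromovProduct o x y ≤ dist x o := by
  have := dist_triangle y x o
  simp only [gromovProduct, dist_comm x y]; linarith

theorem gromovProduct_le_dist_right (o x y : X) : gromovProduct o x y ≤ dist y o := by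
  rw [gromovProduct_comm]; exact gromovProduct_le_dist_left o y x

theorem gromovProduct_add_gromovProduct (o x y : X) :
    gromovProduct o x y + gromovProduct x o y = dist o x := by
  simp only [gromovProduct, dist_comm x o, dist_comm y o, dist_comm y x]; ring

theorem gromovProduct_self_left (x y : X) : gromovProduct x x y = 0 := by
  simp [gromovProduct, dist_comm]

theorem gromovProduct_self_right (x y : X) : gromovProduct y x y = 0 := by
  simp [gromovProduct]

theorem gromovProduct_le_add_left (o x x' y : X) :
    gromovProduct o x y ≤ gromovProduct o x' y + dist x x' := by
  have := dist_triangle x x' o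
  have := dist_triangle x' x y
  simp only [gromovProduct, dist_comm x' x] at *; linarith

theorem gromovProduct_le_add_right (o x y y' : X) :
    gromovProduct o x y ≤ gromovProduct o x y' + dist y y' := by
  rw [gromovProduct_comm o x y, gromovProduct_comm o x y']
  exact gromovProduct_le_add_left o y y' x

theorem gromovProduct_le_add_base (o o' x y : X) :
    gromovProduct o x y ≤ gromovProduct o' x y + dist o o' := by
  have := dist_triangle x o' o
  have := dist_triangle y o' o
  simp only [gromovProduct, dist_comm o' o] at *; linarith

/-- A Gromov product with ends `x`, `y` is at most the one with ends between `x` and `y`. -/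
theorem gromovProduct_le_of_between_right {p x y q : X} (h : dist x q + dist q y = dist x y) :
    gromovProduct p x y ≤ gromovProduct p q y := by
  have := dist_triangle x q p
  simp only [gromovProduct] at *; linarith

theorem gromovProduct_le_of_between_left {p x y q : X} (h : dist x q + dist q y = dist x y) :
    gromovProduct p x y ≤ gromovProduct p x q := by
  have := dist_triangle y q p
  simp only [gromovProduct, dist_comm y q] at *; linarith

theorem IsHyperbolicWith.four_point {δ : ℝ} (hδ : IsHyperbolicWith X δ) (x y z w : X) :
    dist x z + dist y w ≤ max (dist x y + dist z w) (dist y z + dist x w) + 2 * δ := by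
  have h := hδ w x y z
  simp only [gromovProduct] at h
  rcases min_cases ((dist x w + dist y w - dist x y) / 2) ((dist y w + dist z w - dist y z) / 2)
    with ⟨h1, -⟩ | ⟨h1, -⟩ <;> rw [h1] at h
  · have := le_max_left (dist x y + dist z w) (dist y z + dist x w); linarith
  · have := le_max_right (dist x y + dist z w) (dist y z + dist x w); linarith

theorem IsHyperbolicWith.le_or_le {δ : ℝ} (hδ : IsHyperbolicWith X δ) (o x y z : X) :
    gromovProduct o x y ≤ gromovProduct o x z + δ ∨
      gromovProduct o y z ≤ gromovProduct o x z + δ := by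
  have h := hδ o x y z
  rcases min_cases (gromovProduct o x y) (gromovProduct o y z) with ⟨h1, -⟩ | ⟨h1, -⟩ <;>
    rw [h1] at h
  · left; linarith
  · right; linarith

theorem GeodesicMetricSpace.exists_between [GeodesicMetricSpace X] (x y : X) {r : ℝ}
    (h0 : 0 ≤ r) (h1 : r ≤ dist x y) : ∃ q : X, dist x q = r ∧ dist q y = dist x y - r := by
  obtain ⟨γ, hx, hy, h⟩ := GeodesicMetricSpace.exists_geodesic x y
  refine ⟨γ r, ?_, ?_⟩
  · have := h 0 ⟨le_rfl, dist_nonneg⟩ r ⟨h0, h1⟩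
    rw [hx] at this
    rw [this, zero_sub, abs_neg, abs_of_nonneg h0]
  · have := h r ⟨h0, h1⟩ (dist x y) ⟨dist_nonneg, le_rfl⟩
    rw [hy] at this
    rw [this, abs_sub_comm, abs_of_nonneg (by linarith)]

/-- A point `a` with small Gromov product `(x | y)_a` is close to a point between `x` and `y`. -/
theorem IsHyperbolicWith.exists_between_near [GeodesicMetricSpace X] {δ : ℝ}
    (hδ : IsHyperbolicWith X δ) (a x y : X) :
    ∃ q : X, dist x q + dist q y = dist x y ∧ dist x q = gromovProduct x a y ∧
      dist a q ≤ gromovProduct a x y + 2 * δ := by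
  -- `(a | y)_x` is the distance from `x` at which the tripod approximating `x`, `a`, `y` branches.
  obtain ⟨q, h1, h2⟩ := GeodesicMetricSpace.exists_between x y (gromovProduct_nonneg x a y)
    ((gromovProduct_le_dist_right x a y).trans_eq (dist_comm _ _))
  refine ⟨q, by linarith, h1, ?_⟩
  have h := hδ.four_point a x q y
  simp only [gromovProduct, dist_comm y x, dist_comm y a, dist_comm x a] at *
  rcases max_cases (dist a x + dist q y) (dist x q + dist a y) with ⟨h3, -⟩ | ⟨h3, -⟩ <;>
    rw [h3] at h <;> linarith

/-- Every geodesic triangle has a centre. -/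
theorem IsHyperbolicWith.exists_center [GeodesicMetricSpace X] {δ : ℝ} (h0 : 0 ≤ δ)
    (hδ : IsHyperbolicWith X δ) (x y z : X) :
    ∃ p : X, gromovProduct p x y ≤ δ ∧ gromovProduct p y z ≤ δ ∧ gromovProduct p x z ≤ δ := by
  obtain ⟨q, h1, h2, h3⟩ := hδ.exists_between_near z x y
  refine ⟨q, ?_, ?_, ?_⟩ <;>
  · simp only [gromovProduct, dist_comm y x, dist_comm z x, dist_comm z y, dist_comm y q,
      dist_comm z q] at *
    linarith

/-- Two points near the geodesic from `x` to `y` are about as far apart as their distances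
from `x` differ. -/
theorem IsHyperbolicWith.dist_le_of_near {δ M : ℝ} (hδ : IsHyperbolicWith X δ) {x y z z' : X}
    (hz : gromovProduct z x y ≤ M) (hz' : gromovProduct z' x y ≤ M) :
    dist z z' ≤ |dist x z - dist x z'| + 2 * M + 2 * δ := by
  have h := hδ.four_point z x z' y
  simp only [gromovProduct, dist_comm y z, dist_comm y z', dist_comm z x] at *
  have h1 := le_abs_self (dist x z - dist x z')
  have h2 := neg_abs_le (dist x z - dist x z')
  rcases max_cases (dist x z + dist z' y) (dist x z' + dist z y) with ⟨h3, -⟩ | ⟨h3, -⟩ <;>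
    rw [h3] at h <;> linarith

/-- Neighbourhoods of geodesics are quasiconvex. -/
theorem IsHyperbolicWith.near_of_near {δ M C : ℝ} (hδ : IsHyperbolicWith X δ) {x y z z' c : X}
    (hz : gromovProduct z x y ≤ M) (hz' : gromovProduct z' x y ≤ M)
    (hc : gromovProduct c z z' ≤ C) : gromovProduct c x y ≤ M + 2 * C + 2 * δ := by
  have h1 := hδ.four_point c z x z'
  have h2 := hδ.four_point c z y z'
  have t1 := dist_triangle x z z'
  have t2 := dist_triangle x z' z
  have t3 := dist_triangle z c z'
  have t4 := dist_triangle c z z'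
  have t5 := dist_triangle c z' z
  simp only [gromovProduct, dist_comm y z, dist_comm y z', dist_comm z x,
    dist_comm z c, dist_comm z' c, dist_comm z' z, dist_comm x c, dist_comm y c] at *
  rcases max_cases (dist c z + dist x z') (dist x z + dist c z') with ⟨h3, -⟩ | ⟨h3, -⟩ <;>
    rw [h3] at h1 <;>
  rcases max_cases (dist c z + dist z' y) (dist z y + dist c z') with ⟨h4, -⟩ | ⟨h4, -⟩ <;>
    rw [h4] at h2 <;> linarith

/-- Local-to-global principle for broken geodesics. -/
theorem IsHyperbolicWith.gromovProduct_le_of_local {δ A : ℝ} (h0 : 0 < δ)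
    (hδ : IsHyperbolicWith X δ) (hA : 0 ≤ A) {v : ℕ → X}
    (hv : ∀ j, gromovProduct (v (j + 1)) (v j) (v (j + 2)) ≤ A)
    (hd : ∀ j, 2 * A + 5 * δ ≤ dist (v j) (v (j + 1))) {i j k : ℕ} (hij : i ≤ j) (hjk : j ≤ k) :
    gromovProduct (v j) (v i) (v k) ≤ A + 2 * δ := by
  -- The bound reproduces itself: with steps of length at least `2 * A + 5 * δ`, it forces `(v m | v
  -- i)` at `v (m + 1)` to be at least `A + 4 * δ`, which rules out one alternative of the
  -- four-point condition. `step2` is the mirror image, and the two combine at `v j`.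
  have step1 : ∀ i m : ℕ, i + 1 ≤ m → gromovProduct (v m) (v i) (v (m + 1)) ≤ A + δ := by
    intro i m him
    induction m, him using Nat.le_induction with
    | base => have := hv i; linarith
    | succ m him ih =>
      have e := gromovProduct_add_gromovProduct (v m) (v (m + 1)) (v i)
      have h2 := hd m
      have h3 : gromovProduct (v (m + 1)) (v m) (v (m + 1 + 1)) ≤ A := hv m
      rw [gromovProduct_comm (v m)] at e
      rcases hδ.le_or_le (v (m + 1)) (v m) (v i) (v (m + 1 + 1)) with h | h <;> linarith
  have step2 : ∀ d j : ℕ, gromovProduct (v (j + 1)) (v j) (v (j + 2 + d)) ≤ A + δ := by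
    intro d
    induction d with
    | zero => intro j; have := hv j; simp only [add_zero]; linarith
    | succ d ih =>
      intro j
      have e := gromovProduct_add_gromovProduct (v (j + 1)) (v (j + 2)) (v (j + 2 + (d + 1)))
      have i1 := ih (j + 1)
      rw [show j + 1 + 2 + d = j + 2 + (d + 1) by ring] at i1
      have h3 := hv j
      have h4 : _ ≤ dist (v (j + 1)) (v (j + 2)) := hd (j + 1)
      rw [show j + 1 + 1 = j + 2 by ring] at i1
      rcases hδ.le_or_le (v (j + 1)) (v j) (v (j + 2 + (d + 1))) (v (j + 2)) with h | h
      · linarith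
      · rw [gromovProduct_comm] at h
        linarith
  rcases hij.eq_or_lt with rfl | hij
  · rw [gromovProduct_self_left]; linarith
  rcases hjk.eq_or_lt with rfl | hjk
  · rw [gromovProduct_self_right]; linarith
  have h1 := step1 i j hij
  obtain ⟨e, rfl⟩ := Nat.exists_eq_add_of_lt hjk
  rcases Nat.eq_zero_or_pos e with rfl | he
  · simp only [add_zero]; linarith
  obtain ⟨e, rfl⟩ := Nat.exists_eq_succ_of_ne_zero he.ne'
  rw [show j + e.succ + 1 = j + 2 + e by simp only [Nat.succ_eq_add_one]; ring]
  have h2 := step2 e j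
  have e1 := gromovProduct_add_gromovProduct (v j) (v (j + 1)) (v (j + 2 + e))
  have h3 := hd j
  rcases hδ.le_or_le (v j) (v i) (v (j + 2 + e)) (v (j + 1)) with h | h
  · linarith
  · rw [gromovProduct_comm] at h
    linarith

end Hyperbolic

/-! ## Stability of quasigeodesic chains -/

section Morse

variable {X : Type*} [MetricSpace X]

/-- A chain of at most `2 ^ k` steps has a step that is `k * δ`-close to any given point of
a geodesic between its ends. -/
theorem IsHyperbolicWith.exists_step_near {δ : ℝ} (h0 : 0 ≤ δ) (hδ : IsHyperbolicWith X δ)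
    (p : X) (k : ℕ) : ∀ (n : ℕ) (z : ℕ → X), 0 < n → n ≤ 2 ^ k →
      ∃ l < n, gromovProduct p (z l) (z (l + 1)) ≤ gromovProduct p (z 0) (z n) + k * δ := by
  induction k with
  | zero =>
    intro n z hn hnk
    obtain rfl : n = 1 := by simp at hnk; omega
    exact ⟨0, one_pos, by simp⟩
  | succ k ih =>
    intro n z hn hnk
    push_cast
    rcases le_or_gt n (2 ^ k) with h | h
    · obtain ⟨l, hl, h⟩ := ih n z hn h
      exact ⟨l, hl, by linarith⟩
    · rcases hδ.le_or_le p (z 0) (z (2 ^ k)) (z n) with h1 | h1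
      · obtain ⟨l, hl, h2⟩ := ih (2 ^ k) z (by positivity) le_rfl
        exact ⟨l, by omega, by linarith⟩
      · obtain ⟨l, hl, h2⟩ := ih (n - 2 ^ k) (fun i => z (2 ^ k + i)) (by omega)
          (by rw [pow_succ] at hnk; omega)
        simp only [add_zero, Nat.add_sub_cancel' h.le] at h2
        exact ⟨2 ^ k + l, by omega, by rw [add_assoc]; linarith⟩

/-- This bounds the number of steps of a chain by its cost; the `- 1` allows for an unpaired step.
-/
theorem sum_Ico_ge_of_pairs {κ : ℕ → ℝ} {n : ℕ} (h0 : ∀ l < n, 0 ≤ κ l)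
    (h1 : ∀ l, l + 1 < n → 1 ≤ κ l + κ (l + 1)) (m i : ℕ) (hi : i + m ≤ n) :
    ((m : ℝ) - 1) / 2 ≤ ∑ l ∈ Finset.Ico i (i + m), κ l := by
  induction m using Nat.strong_induction_on generalizing i with
  | _ m ih =>
    rcases m with _ | _ | m
    · simp; norm_num
    · simp; exact h0 i (by omega)
    · have h2 := ih m (by omega) (i + 2) (by omega)
      have h3 := h1 i (by omega)
      rw [Finset.sum_eq_sum_Ico_succ_bot (by omega), Finset.sum_eq_sum_Ico_succ_bot (by omega)]
      rw [show i + (m + 1 + 1) = i + 2 + m by ring]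
      push_cast
      linarith

/-- The chain `z 0, …, z n` with step costs `κ` is almost optimal, where the cost of a step may
fall short of its length by at most `W`. -/
structure IsTightChain (W : ℝ) (z : ℕ → X) (κ : ℕ → ℝ) (n : ℕ) : Prop where
  pos : 0 < n
  nonneg : ∀ l < n, 0 ≤ κ l
  pair : ∀ l, l + 1 < n → 1 ≤ κ l + κ (l + 1)
  dist_le : ∀ l < n, dist (z l) (z (l + 1)) ≤ κ l + W
  sum_le : ∀ i j, i ≤ j → j ≤ n → ∑ l ∈ Finset.Ico i j, κ l ≤ dist (z i) (z j) + 1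

theorem exists_between_at [GeodesicMetricSpace X] (x p : X) {r : ℝ} (hr : 0 ≤ r) :
    ∃ a : X, dist x a + dist a p = dist x p ∧ dist a p ≤ r ∧ (a = x ∨ dist a p = r) := by
  rcases le_total (dist x p) r with h | h
  · exact ⟨x, by simp, h, Or.inl rfl⟩
  · obtain ⟨q, h1, h2⟩ := GeodesicMetricSpace.exists_between x p
      (r := dist x p - r) (by linarith) (by linarith)
    exact ⟨q, by linarith, by linarith, Or.inr (by linarith)⟩

/-- Near-optimality and the pair condition bound the number of steps between `q` and `q'` linearly
in `dist q q'`. The dyadic estimate applied to the chain `q, z (i + 1), …, z j, q'` then loses only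
logarithmically much. A step cut off at `q` or `q'` is part of a full step, whose Gromov product at
`p` is no larger. -/
theorem IsTightChain.exists_step_near_of_points {δ W : ℝ} (h0 : 0 ≤ δ) (hW : 0 ≤ W)
    (hδ : IsHyperbolicWith X δ) {z : ℕ → X} {κ : ℕ → ℝ} {n : ℕ} (hz : IsTightChain W z κ n)
    {p q q' : X} {i j k : ℕ} (hi : i < n) (hj : j < n) (hij : i ≤ j)
    (hq : dist (z i) q + dist q (z (i + 1)) = dist (z i) (z (i + 1)))
    (hq' : dist (z j) q' + dist q' (z (j + 1)) = dist (z j) (z (j + 1)))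
    (hp : gromovProduct p q q' ≤ 2 * δ)
    (hk : 2 * (dist q q' + 2 * W + 1) + 3 ≤ 2 ^ k) :
    ∃ l < n, gromovProduct p (z l) (z (l + 1)) ≤ (2 + k) * δ := by
  have hkδ : 0 ≤ k * δ := by positivity
  rcases hij.eq_or_lt with rfl | hij
  · refine ⟨i, hi, ?_⟩
    have hk1 : (1 : ℝ) ≤ k := by
      rcases Nat.eq_zero_or_pos k with rfl | hk0
      · have := dist_nonneg (x := q) (y := q')
        rw [pow_zero] at hk
        linarith
      · exact_mod_cast hk0
    have near : ∀ w : X, dist (z i) w + dist w (z (i + 1)) = dist (z i) (z (i + 1)) →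
        gromovProduct w (z i) (z (i + 1)) ≤ 0 := by
      intro w hw
      simp only [gromovProduct, dist_comm (z (i + 1)) w]
      linarith
    have hd := hδ.dist_le_of_near (near q hq) (near q' hq')
    have t1 := dist_triangle (z i) q p
    have t2 := dist_triangle (z i) q' p
    have t3 := dist_triangle p q (z (i + 1))
    have t4 := dist_triangle p q' (z (i + 1))
    have key : gromovProduct p (z i) (z (i + 1)) ≤ gromovProduct p q q' + δ := by
      simp only [gromovProduct, dist_comm (z (i + 1)) p, dist_comm p q, dist_comm p q'] at *
      rcases abs_cases (dist (z i) q - dist (z i) q') with ⟨h, -⟩ | ⟨h, -⟩ <;>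
        rw [h] at hd <;> linarith
    have : 1 * δ ≤ k * δ := by gcongr
    linarith
  · have hs := hz.sum_le i (j + 1) (by omega) (by omega)
    rw [Finset.sum_eq_sum_Ico_succ_bot (by omega), Finset.sum_Ico_succ_top (by omega)] at hs
    have hm := sum_Ico_ge_of_pairs hz.nonneg hz.pair (j - (i + 1)) (i + 1) (by omega)
    rw [Nat.add_sub_cancel' (by omega : i + 1 ≤ j), Nat.cast_sub (by omega : i + 1 ≤ j)] at hm
    push_cast at hm
    have d1 := hz.dist_le i hi
    have d2 := hz.dist_le j hj
    have t1 := dist_triangle (z i) q (z (j + 1))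
    have t2 := dist_triangle q q' (z (j + 1))
    have hle : ((j - i + 1 : ℕ) : ℝ) ≤ 2 ^ k := by
      rw [Nat.cast_add, Nat.cast_sub hij.le]
      push_cast
      have := dist_nonneg (x := q) (y := z (i + 1))
      have := dist_nonneg (x := z j) (y := q')
      linarith
    obtain ⟨l, hl, h⟩ := hδ.exists_step_near h0 p k (j - i + 1)
      (fun l => if l = 0 then q else if l = j - i + 1 then q' else z (i + l)) (by omega)
      (by exact_mod_cast hle)
    simp only [if_true, Nat.add_eq_zero_iff, one_ne_zero, and_false, if_false,
      add_left_inj] at h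
    refine ⟨i + l, by omega, ?_⟩
    rcases Nat.eq_zero_or_pos l with rfl | hl0
    · have hne : ¬ (0 = j - i) := by omega
      rw [if_pos rfl, if_neg hne] at h
      have := gromovProduct_le_of_between_right (p := p) hq
      simp only [add_zero, zero_add] at *
      linarith
    · rw [if_neg hl0.ne', if_neg hl.ne] at h
      rcases eq_or_ne l (j - i) with rfl | hlj
      · rw [if_pos rfl] at h
        have := gromovProduct_le_of_between_left (p := p) hq'
        rw [Nat.add_sub_cancel' hij.le] at *
        linarith
      · rw [if_neg hlj] at h
        rw [← add_assoc] at h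
        linarith

/-- Exponential growth beats linear growth: `k` is the largest integer permitted by the second
inequality. This makes the bootstrap in the Morse argument gain. -/
theorem eventually_exists_pow_le (δ c : ℝ) (hδ : 0 < δ) :
    ∃ D₀ : ℝ, ∀ D ≥ D₀, ∃ k : ℕ, c * D + c ≤ 2 ^ k ∧ (2 + k) * δ ≤ D - 1 := by
  have h : Tendsto (fun k : ℕ => (|c| * ((3 + k) * δ + 1) + |c|) * (1 / 2 : ℝ) ^ k) atTop (𝓝 0) := by
    have h1 := tendsto_self_mul_const_pow_of_lt_one (r := (1 / 2 : ℝ)) (by norm_num) (by norm_num)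
    have h2 := tendsto_pow_atTop_nhds_zero_of_lt_one (r := (1 / 2 : ℝ)) (by norm_num) (by norm_num)
    have := (h1.const_mul (|c| * δ)).add (h2.const_mul (|c| * (3 * δ + 1) + |c|))
    simp only [mul_zero, add_zero] at this
    refine this.congr fun k => ?_
    ring
  obtain ⟨k₀, hk₀⟩ := eventually_atTop.1 (h.eventually_le_const one_pos)
  refine ⟨(2 + k₀) * δ + 1, fun D hD => ?_⟩
  have hk : (k₀ : ℝ) ≤ (D - 1) / δ - 2 := by
    rw [le_sub_iff_add_le, le_div_iff₀ hδ]; linarith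
  have hnn : 0 ≤ (D - 1) / δ - 2 := (Nat.cast_nonneg _).trans hk
  refine ⟨⌊(D - 1) / δ - 2⌋₊, ?_, ?_⟩
  · have h2 := hk₀ _ (Nat.le_floor hk)
    have h3 := Nat.lt_floor_add_one ((D - 1) / δ - 2)
    set k := ⌊(D - 1) / δ - 2⌋₊
    rw [one_div, inv_pow, ← div_eq_mul_inv, div_le_one (by positivity)] at h2
    refine le_trans ?_ h2
    have h4 : D ≤ (3 + k) * δ + 1 := by
      rw [sub_lt_iff_lt_add, div_lt_iff₀ hδ] at h3; linarith
    have h5 : 0 ≤ D := by nlinarith [(Nat.cast_nonneg k₀ : (0 : ℝ) ≤ k₀)]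
    have := le_abs_self c
    have h6 := abs_nonneg c
    nlinarith
  · have h2 := Nat.floor_le hnn
    rw [le_sub_iff_add_le, le_div_iff₀ hδ] at h2
    linarith

/-- Every point of a geodesic between the ends of a tight chain is close to a step of the chain,
with a bound that depends only on the hyperbolicity constant and on `W`. -/
theorem IsTightChain.exists_step_near_of_between [GeodesicMetricSpace X] {δ W : ℝ} (h1 : 1 ≤ δ)
    (hW : 0 ≤ W) (hδ : IsHyperbolicWith X δ) :
    ∃ M : ℝ, 0 ≤ M ∧ ∀ (z : ℕ → X) (κ : ℕ → ℝ) (n : ℕ), IsTightChain W z κ n → ∀ p : X,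
      dist (z 0) p + dist p (z n) = dist (z 0) (z n) →
      ∃ l < n, gromovProduct p (z l) (z (l + 1)) ≤ M := by
  have h0 : 0 ≤ δ := by linarith
  -- Chosen so that `2 * (6 * D + 14 * δ + 2 * W + 1) + 3`, the bound needed on the number of steps,
  -- is at most `c * D + c`; `1 ≤ δ` absorbs the term `12 * D`.
  obtain ⟨D₀, hD₀⟩ := eventually_exists_pow_le δ (28 * δ + 4 * W + 7) (by linarith)
  have boot : ∀ D : ℝ, max D₀ 0 ≤ D → ∀ (z : ℕ → X) (κ : ℕ → ℝ) (n : ℕ), IsTightChain W z κ n →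
      (∀ p : X, dist (z 0) p + dist p (z n) = dist (z 0) (z n) →
        ∃ l < n, gromovProduct p (z l) (z (l + 1)) ≤ D) →
      (∀ p : X, dist (z 0) p + dist p (z n) = dist (z 0) (z n) →
        ∃ l < n, gromovProduct p (z l) (z (l + 1)) ≤ D - 1) := by
    intro D hD z κ n hz H p hp
    have hD0 : 0 ≤ D := (le_max_right _ _).trans hD
    have hn := hz.pos
    obtain ⟨k, hk1, hk2⟩ := hD₀ D ((le_max_left _ _).trans hD)
    -- Points `a`, `b` on either side of `p`, far enough that chain points `q`, `q'` within `D + 2 *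
    -- δ` of them are still seen from `p` in the directions of `a` and `b`. If the geodesic is too
    -- short, its end is used instead.
    obtain ⟨a, ha1, ha2, ha3⟩ := exists_between_at (z 0) p (r := 2 * D + 5 * δ) (by positivity)
    obtain ⟨b, hb1, hb2, hb3⟩ := exists_between_at (z n) p (r := 2 * D + 5 * δ) (by positivity)
    have ta := dist_triangle (z 0) a (z n)
    have ta' := dist_triangle a p (z n)
    have tb := dist_triangle (z 0) b (z n)
    have tb' := dist_triangle (z 0) p b
    have tab := dist_triangle a p b
    have tab2 := dist_triangle (z 0) a b
    have tab3 := dist_triangle (z 0) b (z n)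
    rw [dist_comm (z n) b, dist_comm b p, dist_comm (z n) p] at hb1
    have hab : gromovProduct p a b = 0 := by
      simp only [gromovProduct, dist_comm b p]
      linarith
    have side : ∀ a : X, dist a p ≤ 2 * D + 5 * δ →
        (a = z 0 ∨ a = z n ∨ dist a p = 2 * D + 5 * δ) →
        dist (z 0) a + dist a (z n) = dist (z 0) (z n) →
        ∃ i < n, ∃ q, dist (z i) q + dist q (z (i + 1)) = dist (z i) (z (i + 1)) ∧
          dist p q ≤ 3 * D + 7 * δ ∧ (q = a ∨ 2 * δ < gromovProduct p a q) := by
      intro a hr ha hbt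
      rcases ha with rfl | rfl | ha
      · exact ⟨0, hn, z 0, by simp, by rw [dist_comm]; linarith, Or.inl rfl⟩
      · refine ⟨n - 1, by omega, z n, ?_, by rw [dist_comm]; linarith, Or.inl rfl⟩
        rw [Nat.sub_add_cancel hn]; simp
      · obtain ⟨i, hi, h⟩ := H a hbt
        obtain ⟨q, hq1, -, hq2⟩ := hδ.exists_between_near a (z i) (z (i + 1))
        have t1 := dist_triangle p a q
        rw [dist_comm p a] at t1
        refine ⟨i, hi, q, hq1, by linarith, Or.inr ?_⟩
        have t2 := dist_triangle p q a
        simp only [gromovProduct, dist_comm q p, dist_comm q a, dist_comm p a] at *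
        linarith
    obtain ⟨i, hi, q, hq1, hq2, hq3⟩ := side a ha2 (by tauto) (by linarith)
    obtain ⟨j, hj, q', hq1', hq2', hq3'⟩ := side b hb2 (by tauto) (by linarith)
    -- `(a | b)_p = 0`; replacing `a` by `q` and then `b` by `q'` costs `δ` each time.
    have hqb : gromovProduct p q b ≤ δ := by
      rcases hq3 with rfl | hq3
      · linarith
      · rcases hδ.le_or_le p a q b with h | h <;> linarith
    have hqq : gromovProduct p q q' ≤ 2 * δ := by
      rcases hq3' with rfl | hq3'
      · linarith
      · rw [gromovProduct_comm] at hq3'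
        rcases hδ.le_or_le p q q' b with h | h <;> linarith
    have hd : dist q q' ≤ 6 * D + 14 * δ := by
      have := dist_triangle_left q q' p
      linarith
    have hk : 2 * (dist q q' + 2 * W + 1) + 3 ≤ 2 ^ k := by
      refine le_trans ?_ hk1
      have : 0 ≤ W * D := by positivity
      have : D ≤ D * δ := le_mul_of_one_le_right hD0 h1
      nlinarith
    rcases le_total i j with hij | hij
    · obtain ⟨l, hl, h⟩ := hz.exists_step_near_of_points h0 hW hδ hi hj hij hq1 hq1' hqq hk
      exact ⟨l, hl, by linarith⟩
    · rw [gromovProduct_comm] at hqq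
      rw [dist_comm] at hk
      obtain ⟨l, hl, h⟩ := hz.exists_step_near_of_points h0 hW hδ hj hi hij hq1' hq1 hqq hk
      exact ⟨l, hl, by linarith⟩
  refine ⟨max D₀ 0, le_max_right _ _, fun z κ n hz => ?_⟩
  -- The trivial bound `dist (z 0) (z n)` is lowered by 1 at a time until it reaches the universal
  -- threshold.
  have descend : ∀ m : ℕ, ∀ p : X, dist (z 0) p + dist p (z n) = dist (z 0) (z n) →
      ∃ l < n, gromovProduct p (z l) (z (l + 1)) ≤ max (max D₀ 0) (dist (z 0) (z n) - m) := by
    intro m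
    induction m with
    | zero =>
      intro p hp
      refine ⟨0, hz.pos, ?_⟩
      have := gromovProduct_le_dist_left p (z 0) (z (0 + 1))
      have := dist_nonneg (x := p) (y := z n)
      rw [Nat.cast_zero, sub_zero]
      exact le_max_of_le_right (by linarith)
    | succ m ih =>
      intro p hp
      rcases le_total (dist (z 0) (z n) - m) (max D₀ 0) with h | h
      · obtain ⟨l, hl, h2⟩ := ih p hp
        rw [max_eq_left h] at h2
        exact ⟨l, hl, le_max_of_le_left h2⟩
      · rw [max_eq_right h] at ih
        obtain ⟨l, hl, h2⟩ := boot _ h z κ n hz ih p hp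
        refine ⟨l, hl, le_max_of_le_right ?_⟩
        push_cast; linarith
  obtain ⟨m, hm⟩ := exists_nat_ge (dist (z 0) (z n))
  intro p hp
  obtain ⟨l, hl, h⟩ := descend m p hp
  refine ⟨l, hl, h.trans (max_le le_rfl ?_)⟩
  exact le_trans (by linarith) (le_max_right _ _)

end Morse

/-! ## The asymmetric metric obtained by adding directed shortcuts -/

section Shortcut

variable {X : Type*} [MetricSpace X]

/-- The cost of the path from `x` to `y` that runs through the directed shortcuts in the list, each
of which saves `W`. -/
noncomputable def chainCost (W : ℝ) : X → List (X × X) → X → ℝ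
  | x, [], y => dist x y
  | x, p :: L, y => dist x p.1 + (dist p.1 p.2 - W) + chainCost W p.2 L y

/-- The least cost of a path from `x` to `y` with shortcuts in `Q`. -/
noncomputable def shortcutDist (W : ℝ) (Q : Set (X × X)) (x y : X) : ℝ :=
  ⨅ L : {L : List (X × X) // ∀ p ∈ L, p ∈ Q}, chainCost W x L.1 y

/-- All shortcuts in `Q` are long compared with what they save. -/
def LongShortcuts (W : ℝ) (Q : Set (X × X)) : Prop :=
  ∀ p ∈ Q, 2 * W ≤ dist p.1 p.2

variable {W : ℝ} {Q : Set (X × X)}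

/-- A shortcut that saves `W` on a length of at least `2 * W` still costs half its length. This
makes the infimum defining `shortcutDist` meaningful and comparable to the metric. -/
theorem half_dist_le_chainCost (hQ : LongShortcuts W Q) (x y : X) (L : List (X × X))
    (hL : ∀ p ∈ L, p ∈ Q) : dist x y / 2 ≤ chainCost W x L y := by
  induction L generalizing x with
  | nil => simp only [chainCost]; linarith [dist_nonneg (x := x) (y := y)]
  | cons p L ih =>
    have h1 := ih p.2 fun q hq => hL q (List.mem_cons_of_mem _ hq)
    have h2 := hQ p (hL p List.mem_cons_self)
    have := dist_triangle x p.1 y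
    have := dist_triangle p.1 p.2 y
    have := dist_nonneg (x := x) (y := p.1)
    simp only [chainCost]; linarith

theorem chainCost_append_le (x y z : X) (L L' : List (X × X)) :
    chainCost W x (L ++ L') z ≤ chainCost W x L y + chainCost W y L' z := by
  induction L generalizing x with
  | nil =>
    cases L' with
    | nil => exact dist_triangle _ _ _
    | cons p L' =>
      have := dist_triangle x y p.1
      simp only [chainCost, List.nil_append]; linarith
  | cons p L ih =>
    have := ih p.2
    simp only [chainCost, List.cons_append]; linarith

theorem bddBelow_chainCost (hQ : LongShortcuts W Q) (x y : X) :
    BddBelow (Set.range fun L : {L : List (X × X) // ∀ p ∈ L, p ∈ Q} => chainCost W x L.1 y) := by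
  refine ⟨dist x y / 2, ?_⟩
  rintro _ ⟨L, rfl⟩
  exact half_dist_le_chainCost hQ x y L.1 L.2

instance : Nonempty {L : List (X × X) // ∀ p ∈ L, p ∈ Q} := ⟨⟨[], by simp⟩⟩

theorem shortcutDist_le_chainCost (hQ : LongShortcuts W Q) (x y : X) {L : List (X × X)}
    (hL : ∀ p ∈ L, p ∈ Q) : shortcutDist W Q x y ≤ chainCost W x L y :=
  ciInf_le (bddBelow_chainCost hQ x y) ⟨L, hL⟩

theorem shortcutDist_le_dist (hQ : LongShortcuts W Q) (x y : X) :
    shortcutDist W Q x y ≤ dist x y :=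
  shortcutDist_le_chainCost hQ x y (L := []) (by simp)

theorem shortcutDist_le_of_mem (hQ : LongShortcuts W Q) {p : X × X} (hp : p ∈ Q) :
    shortcutDist W Q p.1 p.2 ≤ dist p.1 p.2 - W := by
  have := shortcutDist_le_chainCost hQ p.1 p.2 (L := [p]) (by simpa using hp)
  simpa [chainCost] using this

theorem half_dist_le_shortcutDist (hQ : LongShortcuts W Q) (x y : X) :
    dist x y / 2 ≤ shortcutDist W Q x y :=
  le_ciInf fun L => half_dist_le_chainCost hQ x y L.1 L.2

theorem exists_chainCost_lt (x y : X) {ε : ℝ} (hε : 0 < ε) :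
    ∃ L : List (X × X), (∀ p ∈ L, p ∈ Q) ∧ chainCost W x L y < shortcutDist W Q x y + ε := by
  obtain ⟨L, hL⟩ := exists_lt_of_ciInf_lt (lt_add_of_pos_right (shortcutDist W Q x y) hε)
  exact ⟨L.1, L.2, hL⟩

theorem shortcutDist_triangle (hQ : LongShortcuts W Q) (x y z : X) :
    shortcutDist W Q x z ≤ shortcutDist W Q x y + shortcutDist W Q y z := by
  refine le_of_forall_pos_le_add fun ε hε => ?_
  obtain ⟨L, hL, h1⟩ := exists_chainCost_lt (W := W) (Q := Q) x y (half_pos hε)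
  obtain ⟨L', hL', h2⟩ := exists_chainCost_lt (W := W) (Q := Q) y z (half_pos hε)
  have h3 := shortcutDist_le_chainCost hQ x z (L := L ++ L')
    (by simpa [or_imp, forall_and] using ⟨fun a b => hL (a, b), fun a b => hL' (a, b)⟩)
  have := chainCost_append_le (W := W) x y z L L'
  linarith

theorem chainCost_smul {Γ : Type*} [Group Γ] [MulAction Γ X] [IsIsometricSMul Γ X] (g : Γ)
    (x y : X) (L : List (X × X)) :
    chainCost W (g • x) (L.map (g • ·)) (g • y) = chainCost W x L y := by
  induction L generalizing x with
  | nil => simp [chainCost]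
  | cons p L ih => simp [chainCost, ih]

theorem shortcutDist_smul_le {Γ : Type*} [Group Γ] [MulAction Γ X] [IsIsometricSMul Γ X]
    (hQ : LongShortcuts W Q) (hinv : ∀ (g : Γ), ∀ p ∈ Q, g • p ∈ Q) (g : Γ) (x y : X) :
    shortcutDist W Q (g • x) (g • y) ≤ shortcutDist W Q x y := by
  refine le_ciInf fun L => ?_
  rw [← chainCost_smul (W := W) g x y L.1]
  refine shortcutDist_le_chainCost hQ _ _ fun p hp => ?_
  obtain ⟨q, hq, rfl⟩ := List.mem_map.1 hp
  exact hinv g q (L.2 q hq)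

theorem shortcutDist_smul {Γ : Type*} [Group Γ] [MulAction Γ X] [IsIsometricSMul Γ X]
    (hQ : LongShortcuts W Q) (hinv : ∀ (g : Γ), ∀ p ∈ Q, g • p ∈ Q) (g : Γ) (x y : X) :
    shortcutDist W Q (g • x) (g • y) = shortcutDist W Q x y := by
  refine le_antisymm (shortcutDist_smul_le hQ hinv g x y) ?_
  simpa using shortcutDist_smul_le hQ hinv g⁻¹ (g • x) (g • y)

/-- The sequence of vertices of a chain of shortcuts, with the costs of its steps. -/
theorem exists_vertices (hW : 1 ≤ W) (hQ : LongShortcuts W Q) (x y : X) (L : List (X × X))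
    (hL : ∀ p ∈ L, p ∈ Q) : ∃ (z : ℕ → X) (κ : ℕ → ℝ) (n : ℕ), 0 < n ∧ z 0 = x ∧ z n = y ∧
      (∀ l < n, 0 ≤ κ l) ∧ (∀ l, l + 1 < n → 1 ≤ κ l + κ (l + 1)) ∧
      (∀ l < n, dist (z l) (z (l + 1)) ≤ κ l + W) ∧
      (∀ l < n, shortcutDist W Q (z l) (z (l + 1)) ≤ κ l) ∧
      ∑ l ∈ Finset.range n, κ l = chainCost W x L y := by
  induction L generalizing x with
  | nil =>
    refine ⟨fun l => if l = 0 then x else y, fun _ => dist x y, 1, one_pos, by simp, by simp,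
      fun _ _ => dist_nonneg, fun l hl => by omega, fun l hl => ?_, fun l hl => ?_, by
        simp [chainCost]⟩
    · obtain rfl : l = 0 := by omega
      simp; linarith
    · obtain rfl : l = 0 := by omega
      simpa using shortcutDist_le_dist hQ x y
  | cons p L ih =>
    obtain ⟨z, κ, n, hn, h0, h1, h2, h3, h4, h5, h6⟩ :=
      ih p.2 fun q hq => hL q (List.mem_cons_of_mem _ hq)
    have hpQ := hL p List.mem_cons_self
    have hp := hQ p hpQ
    refine ⟨fun l => Nat.casesOn l x fun l => Nat.casesOn l p.1 z,
      fun l => Nat.casesOn l (dist x p.1) fun l => Nat.casesOn l (dist p.1 p.2 - W) κ, n + 2,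
      by omega, rfl, h1, ?_, ?_, ?_, ?_, ?_⟩
    · rintro (_ | _ | l) hl
      · exact dist_nonneg
      · simp; linarith
      · exact h2 l (by omega)
    · rintro (_ | _ | l) hl
      · have := dist_nonneg (x := x) (y := p.1)
        simp; linarith
      · have := h2 0 hn
        simp; linarith
      · exact h3 l (by omega)
    · rintro (_ | _ | l) hl
      · simp; linarith
      · simp [h0]
      · exact h4 l (by omega)
    · rintro (_ | _ | l) hl
      · exact shortcutDist_le_dist hQ _ _
      · simpa [h0] using shortcutDist_le_of_mem hQ hpQ
      · exact h5 l (by omega)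
    · rw [Finset.sum_range_succ', Finset.sum_range_succ']
      simp only [chainCost, ← h6]
      change ∑ l ∈ Finset.range n, κ l + (dist p.1 p.2 - W) + dist x p.1 = _
      ring

theorem shortcutDist_le_sum (hQ : LongShortcuts W Q) {z : ℕ → X} {κ : ℕ → ℝ} {n : ℕ}
    (h : ∀ l < n, shortcutDist W Q (z l) (z (l + 1)) ≤ κ l) {i j : ℕ} (hij : i ≤ j) (hj : j ≤ n) :
    shortcutDist W Q (z i) (z j) ≤ ∑ l ∈ Finset.Ico i j, κ l := by
  induction j, hij using Nat.le_induction with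
  | base => simpa using shortcutDist_le_dist hQ (z i) (z i)
  | succ j hij ih =>
    rw [Finset.sum_Ico_succ_top hij]
    have := ih (by omega)
    have := h j (by omega)
    have := shortcutDist_triangle hQ (z i) (z j) (z (j + 1))
    linarith

/-- Almost optimal paths pass near the points of a geodesic. -/
theorem exists_shortcutDist_add_le [GeodesicMetricSpace X] {δ : ℝ} (h1 : 1 ≤ δ)
    (hδ : IsHyperbolicWith X δ) (hW : 1 ≤ W) :
    ∃ C : ℝ, 0 ≤ C ∧ ∀ Q : Set (X × X), LongShortcuts W Q → ∀ x y p : X,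
      gromovProduct p x y ≤ δ →
      shortcutDist W Q x p + shortcutDist W Q p y ≤ shortcutDist W Q x y + C := by
  obtain ⟨M, hM0, hM⟩ := IsTightChain.exists_step_near_of_between h1 (by linarith : 0 ≤ W) hδ
  -- The summand 1 is the excess of the chosen path, `W` the saving of the step that is broken up,
  -- `2 * M` the detour from that step to `q`, and `6 * δ` the way from `q` to `p` and back.
  refine ⟨1 + W + 2 * M + 6 * δ, by linarith, fun Q hQ x y p hp => ?_⟩
  obtain ⟨L, hL, hlt⟩ := exists_chainCost_lt (W := W) (Q := Q) x y one_pos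
  obtain ⟨z, κ, n, hn, h0, hzn, h2, h3, h4, h5, h6⟩ := exists_vertices hW hQ x y L hL
  have hsum : ∀ i j, i ≤ j → j ≤ n → ∑ l ∈ Finset.Ico i j, κ l ≤
      shortcutDist W Q (z i) (z j) + 1 := by
    intro i j hij hj
    have e1 := Finset.sum_range_add_sum_Ico κ (hij.trans hj)
    have e2 := Finset.sum_Ico_consecutive κ hij hj
    simp only [Finset.range_eq_Ico] at e1
    have t1 := shortcutDist_le_sum hQ h5 (Nat.zero_le i) (hij.trans hj)
    have t2 := shortcutDist_le_sum hQ h5 hj le_rfl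
    have t3 := shortcutDist_triangle hQ x (z i) y
    have t4 := shortcutDist_triangle hQ (z i) (z j) y
    rw [h0] at t1
    rw [hzn] at t2
    rw [Finset.range_eq_Ico] at h6
    linarith
  have tight : IsTightChain W z κ n := ⟨hn, h2, h3, h4, fun i j hij hj => by
    have := hsum i j hij hj
    have := shortcutDist_le_dist hQ (z i) (z j)
    linarith⟩
  obtain ⟨q, hq1, -, hq2⟩ := hδ.exists_between_near p x y
  obtain ⟨l, hl, h⟩ := hM z κ n tight q (by rw [h0, hzn]; exact hq1)
  have e1 := Finset.sum_range_add_sum_Ico κ hl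
  rw [Finset.sum_range_succ] at e1
  have t1 := shortcutDist_le_sum hQ h5 (Nat.zero_le l) hl.le
  have t2 := shortcutDist_le_sum hQ h5 (i := l + 1) hl le_rfl
  rw [← Finset.range_eq_Ico, h0] at t1
  rw [hzn] at t2
  have t3 := shortcutDist_triangle hQ x (z l) p
  have t4 := shortcutDist_triangle hQ p (z (l + 1)) y
  have t5 := shortcutDist_le_dist hQ (z l) p
  have t6 := shortcutDist_le_dist hQ p (z (l + 1))
  have t7 := dist_triangle (z l) q p
  have t8 := dist_triangle p q (z (l + 1))
  have t9 := h4 l hl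
  simp only [gromovProduct, dist_comm (z (l + 1)) q, dist_comm q p] at *
  linarith

/-- Points on almost optimal paths are near geodesics. -/
theorem exists_near_of_shortcutDist [GeodesicMetricSpace X] {δ : ℝ} (h1 : 1 ≤ δ)
    (hδ : IsHyperbolicWith X δ) (hW : 1 ≤ W) :
    ∃ M : ℝ, 0 ≤ M ∧ ∀ Q : Set (X × X), LongShortcuts W Q → ∀ x y z : X,
      shortcutDist W Q x z + shortcutDist W Q z y ≤ shortcutDist W Q x y + 1 →
      gromovProduct z x y ≤ M := by
  obtain ⟨C, hC0, hC⟩ := exists_shortcutDist_add_le h1 hδ hW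
  refine ⟨2 * C + 1 + δ, by linarith, fun Q hQ x y z h => ?_⟩
  -- A path through `z` passes near the centre `p` before and after `z`. This backtracking costs at
  -- least `dist p z`, so near-optimality bounds `dist p z`.
  obtain ⟨p, h2, h3, h4⟩ := hδ.exists_center (by linarith) x y z
  rw [gromovProduct_comm] at h3
  have t1 := hC Q hQ x z p h4
  have t2 := hC Q hQ z y p h3
  have t3 := shortcutDist_triangle hQ x p y
  have t4 := half_dist_le_shortcutDist hQ p z
  have t5 := half_dist_le_shortcutDist hQ z p
  have t6 := gromovProduct_le_add_base z p x y
  rw [dist_comm p z] at t4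
  linarith

/-- The antisymmetrization of `shortcutDist`. -/
noncomputable def shortcutForm (W : ℝ) (Q : Set (X × X)) (x y : X) : ℝ :=
  shortcutDist W Q x y - shortcutDist W Q y x

/-- Up to `C`, each of the three terms splits at the centre `p` of the triangle, and the six
resulting terms cancel by antisymmetry. Uniformity in `Q` is what allows infinite sums of
quasimorphisms later. -/
theorem exists_shortcutForm_cocycle_bound [GeodesicMetricSpace X] {δ : ℝ} (h1 : 1 ≤ δ)
    (hδ : IsHyperbolicWith X δ) (hW : 1 ≤ W) :
    ∃ D : ℝ, 0 ≤ D ∧ ∀ Q : Set (X × X), LongShortcuts W Q → ∀ x y z : X,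
      |shortcutForm W Q x y + shortcutForm W Q y z - shortcutForm W Q x z| ≤ D := by
  obtain ⟨C, hC0, hC⟩ := exists_shortcutDist_add_le h1 hδ hW
  refine ⟨3 * C, by linarith, fun Q hQ x y z => ?_⟩
  obtain ⟨p, h2, h3, h4⟩ := hδ.exists_center (by linarith) x y z
  have tri := shortcutDist_triangle hQ
  have a1 := hC Q hQ x y p h2
  have a2 := hC Q hQ y z p h3
  have a3 := hC Q hQ x z p h4
  rw [gromovProduct_comm] at h2 h3 h4
  have b1 := hC Q hQ y x p h2
  have b2 := hC Q hQ z y p h3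
  have b3 := hC Q hQ z x p h4
  have := tri x p y
  have := tri y p x
  have := tri y p z
  have := tri z p y
  have := tri x p z
  have := tri z p x
  simp only [shortcutForm]
  rw [abs_le]; constructor <;> linarith

/-- A single shortcut already costs as much as going straight, in either direction. -/
theorem shortcutForm_of_forall_dist_le (hQ : LongShortcuts W Q) {x y : X}
    (h : ∀ p ∈ Q, dist x y ≤ dist p.1 p.2 - W) : shortcutForm W Q x y = 0 := by
  have key : ∀ x y : X, (∀ p ∈ Q, dist x y ≤ dist p.1 p.2 - W) →
      shortcutDist W Q x y = dist x y := by
    intro x y h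
    refine le_antisymm (shortcutDist_le_dist hQ x y) (le_ciInf ?_)
    rintro ⟨_ | ⟨p, L⟩, hL⟩
    · exact le_rfl
    · have t1 := half_dist_le_chainCost hQ p.2 y L fun q hq => hL q (List.mem_cons_of_mem _ hq)
      have t2 := h p (hL p List.mem_cons_self)
      have := dist_nonneg (x := x) (y := p.1)
      have := dist_nonneg (x := p.2) (y := y)
      simp only [chainCost]; linarith
  rw [shortcutForm, key x y h, key y x (by simpa only [dist_comm y x] using h), dist_comm, sub_self]

/-- If paths from `x` to `y` can profit from shortcuts, then some shortcut runs along the geodesic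
from `x` to `y`, in this direction. -/
theorem exists_shortcut_near [GeodesicMetricSpace X] {δ : ℝ} (h1 : 1 ≤ δ)
    (hδ : IsHyperbolicWith X δ) (hW : 1 ≤ W) :
    ∃ M : ℝ, 0 ≤ M ∧ ∀ Q : Set (X × X), LongShortcuts W Q → ∀ x y : X,
      dist x y - 1 ≤ shortcutDist W Q x y ∨
      ∃ p ∈ Q, gromovProduct p.1 x y ≤ M ∧ gromovProduct p.2 x y ≤ M ∧
        gromovProduct p.1 x p.2 ≤ M := by
  obtain ⟨M, hM0, hM⟩ := exists_near_of_shortcutDist h1 hδ hW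
  refine ⟨M, hM0, fun Q hQ x y => or_iff_not_imp_left.2 fun hlt => ?_⟩
  obtain ⟨L, hL, h⟩ := exists_chainCost_lt (W := W) (Q := Q) x y one_pos
  -- The empty list costs `dist x y`, so a profitable path has a first shortcut `p`. Both of its
  -- ends lie on a nearly optimal path from `x` to `y`, and `p.1` on one from `x` to `p.2`, which
  -- fixes the direction.
  rcases L with _ | ⟨p, L⟩
  · simp only [chainCost] at h
    linarith
  · have hp := hL p List.mem_cons_self
    have t1 := shortcutDist_le_chainCost hQ p.2 y (L := L)
      fun q hq => hL q (List.mem_cons_of_mem _ hq)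
    have t2 := shortcutDist_le_of_mem hQ hp
    have t3 := shortcutDist_le_dist hQ x p.1
    have tri := shortcutDist_triangle hQ
    have := tri p.1 p.2 y
    have := tri x p.1 p.2
    have := tri x p.2 y
    simp only [chainCost] at h
    exact ⟨p, hp, hM Q hQ _ _ _ (by linarith), hM Q hQ _ _ _ (by linarith),
      hM Q hQ _ _ _ (by linarith)⟩

end Shortcut

/-! ## Orbits of loxodromic elements -/

/-! ### Discrete intermediate values -/

section DiscreteIVT

theorem exists_abs_sub_le_of_le {f : ℕ → ℝ} {σ v : ℝ} (hf : ∀ i, |f (i + 1) - f i| ≤ σ) {n : ℕ}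
    (h0 : f 0 ≤ v) (h1 : v ≤ f n) : ∃ i ≤ n, |f i - v| ≤ σ := by
  induction n with
  | zero =>
    have h2 : f 0 = v := le_antisymm h0 h1
    exact ⟨0, le_rfl, by rw [h2, sub_self, abs_zero]; exact (abs_nonneg _).trans (hf 0)⟩
  | succ n ih =>
    rcases le_total v (f n) with h | h
    · obtain ⟨i, hi, h⟩ := ih h
      exact ⟨i, by omega, h⟩
    · refine ⟨n + 1, le_rfl, ?_⟩
      have := (abs_le.1 (hf n)).2
      rw [abs_of_nonneg (by linarith)]
      linarith

/-- A discrete intermediate value theorem. -/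
theorem exists_mem_uIcc_abs_sub_le {f : ℤ → ℝ} {σ v : ℝ} (hf : ∀ i, |f (i + 1) - f i| ≤ σ)
    {a b : ℤ} (hv : v ∈ Set.uIcc (f a) (f b)) : ∃ i ∈ Set.uIcc a b, |f i - v| ≤ σ := by
  wlog hab : a ≤ b generalizing a b
  · rw [Set.uIcc_comm] at hv ⊢
    exact this hv (le_of_not_ge hab)
  wlog hfab : f a ≤ f b generalizing f v
  · obtain ⟨i, hi, h⟩ := this (f := fun i => -f i) (v := -v)
      (fun i => by rw [← abs_neg]; convert hf i using 2; ring)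
      (by
        rw [Set.uIcc_of_ge (le_of_not_ge hfab)] at hv
        rw [Set.uIcc_of_le (neg_le_neg (le_of_not_ge hfab))]
        exact ⟨neg_le_neg hv.2, neg_le_neg hv.1⟩)
      (neg_le_neg (le_of_not_ge hfab))
    refine ⟨i, hi, ?_⟩
    rw [← abs_neg]; convert h using 2; ring
  rw [Set.uIcc_of_le hfab] at hv
  obtain ⟨i, hi, h⟩ := exists_abs_sub_le_of_le (f := fun n : ℕ => f (a + n)) (v := v)
    (n := (b - a).toNat) (fun i => by convert hf (a + i) using 4; push_cast; ring)
    (by simpa using hv.1) (by simpa [Int.toNat_of_nonneg (sub_nonneg.2 hab)] using hv.2)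
  refine ⟨a + i, ?_, h⟩
  rw [Set.uIcc_of_le hab]
  constructor <;> omega

end DiscreteIVT

/-! ### Orbits as quasigeodesic lines, and their endpoints -/

section Orbit

variable {Γ : Type*} [Group Γ] {X : Type*} [MetricSpace X] [MulAction Γ X]

/-- The orbit of `x` under the powers of `h` is a quasigeodesic line: it is quasi-isometrically
embedded and orbit points lie near the geodesics between later and earlier ones. -/
structure IsQuasiAxis (h : Γ) (x : X) (K C : ℝ) : Prop where
  one_le : 1 ≤ K
  nonneg : 0 ≤ C
  near : ∀ i j k : ℤ, i ≤ j → j ≤ k → gromovProduct (h ^ j • x) (h ^ i • x) (h ^ k • x) ≤ C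
  lower : ∀ i j : ℤ, |(i : ℝ) - j| / K - C ≤ dist (h ^ i • x) (h ^ j • x)

theorem IsQuasiAxis.near_uIcc {h : Γ} {x : X} {K C : ℝ} (H : IsQuasiAxis h x K C) {i j k : ℤ}
    (hj : j ∈ Set.uIcc i k) : gromovProduct (h ^ j • x) (h ^ i • x) (h ^ k • x) ≤ C := by
  rcases Set.mem_uIcc.1 hj with ⟨h1, h2⟩ | ⟨h1, h2⟩
  · exact H.near _ _ _ h1 h2
  · rw [gromovProduct_comm]; exact H.near _ _ _ h1 h2

theorem IsQuasiAxis.inv {h : Γ} {x : X} {K C : ℝ} (H : IsQuasiAxis h x K C) :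
    IsQuasiAxis h⁻¹ x K C := by
  refine ⟨H.one_le, H.nonneg, fun i j k hij hjk => ?_, fun i j => ?_⟩
  · simp only [inv_zpow']
    rw [gromovProduct_comm]
    exact H.near _ _ _ (by omega) (by omega)
  · simp only [inv_zpow']
    refine le_trans (le_of_eq ?_) (H.lower (-i) (-j))
    push_cast
    rw [← abs_neg]; congr 3; ring

theorem IsQuasiAxis.isGromovSequence {h : Γ} {x : X} {K C : ℝ} (H : IsQuasiAxis h x K C) :
    IsGromovSequence (fun n : ℕ => h ^ n • x) := by
  intro o
  have hK : 0 < K := by linarith [H.one_le]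
  have key : ∀ m n : ℕ, m ≤ n →
      (m : ℝ) / K - 2 * C - dist o x ≤ gromovProduct o (h ^ m • x) (h ^ n • x) := by
    intro m n hmn
    have h1 := H.near 0 m n (by omega) (by omega)
    have h2 := H.lower 0 m
    have h3 := gromovProduct_add_gromovProduct x (h ^ m • x) (h ^ n • x)
    have h4 := gromovProduct_le_add_base x o (h ^ m • x) (h ^ n • x)
    simp only [zpow_zero, one_smul, zpow_natCast, Int.cast_zero, Int.cast_natCast, zero_sub, abs_neg,
      Nat.abs_cast, dist_comm x o] at *
    linarith
  refine tendsto_atTop.2 fun b => ?_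
  obtain ⟨N, hN⟩ := exists_nat_ge ((b + 2 * C + dist o x) * K)
  rw [← le_div_iff₀ hK] at hN
  filter_upwards [eventually_ge_atTop (N, N)] with p hp
  have hp1 : (N : ℝ) ≤ p.1 := by exact_mod_cast hp.1
  have hp2 : (N : ℝ) ≤ p.2 := by exact_mod_cast hp.2
  rcases le_total p.1 p.2 with h | h
  · have := key _ _ h
    have : (N : ℝ) / K ≤ p.1 / K := by gcongr
    linarith
  · have := key _ _ h
    rw [gromovProduct_comm]
    have : (N : ℝ) / K ≤ p.2 / K := by gcongr
    linarith

variable [IsIsometricSMul Γ X]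

theorem gromovProduct_smul_smul (g : Γ) (o x y : X) :
    gromovProduct (g • o) (g • x) (g • y) = gromovProduct o x y := by
  simp only [gromovProduct, dist_smul]

theorem dist_zpow_smul (h : Γ) (x : X) (i j : ℤ) :
    dist (h ^ i • x) (h ^ j • x) = dist x (h ^ (j - i) • x) := by
  rw [← dist_smul (h ^ i) x, smul_smul, ← zpow_add]
  congr 3; ring

theorem dist_zpow_succ_smul (h : Γ) (x : X) (i : ℤ) :
    dist (h ^ i • x) (h ^ (i + 1) • x) = dist x (h • x) := by
  rw [dist_zpow_smul]; simp

theorem dist_pow_smul_le (h : Γ) (x : X) (n : ℕ) :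
    dist x (h ^ n • x) ≤ n * dist x (h • x) := by
  induction n with
  | zero => simp
  | succ n ih =>
    have h1 := dist_triangle x (h ^ n • x) (h ^ (n + 1) • x)
    rw [pow_succ h n, mul_smul, dist_smul, ← mul_smul, ← pow_succ] at h1
    push_cast; linarith

theorem dist_zpow_neg_smul (h : Γ) (x : X) (i : ℤ) :
    dist x (h ^ (-i) • x) = dist x (h ^ i • x) := by
  have := dist_zpow_smul h x i 0
  simpa [dist_comm] using this.symm

theorem dist_zpow_smul_le (h : Γ) (x : X) (i : ℤ) :
    dist x (h ^ i • x) ≤ |(i : ℝ)| * dist x (h • x) := by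
  rcases Int.eq_nat_or_neg i with ⟨n, rfl | rfl⟩
  · simpa using dist_pow_smul_le h x n
  · rw [dist_zpow_neg_smul]; simpa using dist_pow_smul_le h x n

/-- Some `n` satisfies `dist x (h ^ n • x) + 5 * δ ≤ dist x (h ^ (2 * n) • x)`, since otherwise the
displacement of `h ^ (2 ^ k)` would grow only linearly in `k`. This is the hypothesis of the
local-to-global principle for the orbit of `h ^ n`; other exponents are rounded to multiples of `n`.
-/
theorem IsLoxodromic.exists_isQuasiAxis {δ : ℝ} (h1 : 1 ≤ δ) (hδ : IsHyperbolicWith X δ) {h : Γ}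
    (hh : IsLoxodromic X h) (x : X) : ∃ K C : ℝ, IsQuasiAxis h x K C := by
  obtain ⟨K, C, hK, hC, hq⟩ := hh x
  have hK0 : 0 < K := by linarith
  set σ := dist x (h • x)
  have hσ : 0 ≤ σ := dist_nonneg
  obtain ⟨n, hn, hgap⟩ : ∃ n : ℕ, 0 < n ∧
      dist x (h ^ n • x) + 5 * δ ≤ dist x (h ^ (2 * n) • x) := by
    by_contra! hcon
    have hpow : ∀ k : ℕ, dist x (h ^ (2 ^ k) • x) ≤ σ + k * (5 * δ) := by
      intro k
      induction k with
      | zero => simp [σ]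
      | succ k ih =>
        have := hcon (2 ^ k) (by positivity)
        rw [pow_succ, mul_comm]; push_cast; linarith
    obtain ⟨D₀, hD₀⟩ := eventually_exists_pow_le 1 (K * (σ + C) + K * (5 * δ) + 1) one_pos
    obtain ⟨k, hk, hk'⟩ := hD₀ (max D₀ 0) (le_max_left _ _)
    have h2 := (hq 0 (2 ^ k : ℕ)).1
    rw [zpow_natCast, zpow_zero, one_smul, Int.cast_zero, zero_sub, abs_neg] at h2
    push_cast at h2
    rw [abs_of_nonneg (by positivity)] at h2
    have h3 : (2 : ℝ) ^ k / K ≤ σ + C + k * (5 * δ) := by linarith [hpow k]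
    rw [div_le_iff₀ hK0] at h3
    have h4 : (k : ℝ) ≤ max D₀ 0 := by linarith
    have h5 : 0 ≤ max D₀ 0 := le_max_right _ _
    generalize max D₀ 0 = D at *
    have h6 : 0 ≤ K * (σ + C) * D := by positivity
    have h7 : K * (5 * δ) * k ≤ K * (5 * δ) * D := by gcongr
    have h8 : 0 < K * (5 * δ) := by positivity
    nlinarith
  -- The Gromov product at `x` of its images under `h ^ n` and its inverse; `hgap` says that a step
  -- has length at least `2 * A + 5 * δ`.
  set A := (2 * dist x (h ^ n • x) - dist x (h ^ (2 * n) • x)) / 2 with hA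
  have hA0 : 0 ≤ A := by
    have := dist_triangle x (h ^ n • x) (h ^ (2 * n) • x)
    rw [two_mul n, pow_add, mul_smul, dist_smul, ← mul_smul, ← pow_add, ← two_mul] at this
    linarith
  have hH : ∀ i j k : ℤ, i ≤ j → j ≤ k → gromovProduct ((h ^ n) ^ j • x) ((h ^ n) ^ i • x)
      ((h ^ n) ^ k • x) ≤ A + 2 * δ := by
    intro i j k hij hjk
    have := hδ.gromovProduct_le_of_local (by linarith) hA0
      (v := fun l : ℕ => (h ^ n) ^ (i + l) • x) ?_ ?_ (i := 0) (j := (j - i).toNat)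
      (k := (k - i).toNat) (by omega) (by omega)
    · simpa [Int.toNat_of_nonneg (sub_nonneg.2 hij),
        Int.toNat_of_nonneg (sub_nonneg.2 (hij.trans hjk))] using this
    · intro l
      simp only [gromovProduct, dist_zpow_smul]
      push_cast
      rw [show i + (l + 1) - (i + l : ℤ) = 1 by ring, show i + (l + 1) - (i + (l + 2) : ℤ) = -1 by ring,
        show i + (l + 2) - (i + l : ℤ) = 2 by ring, dist_zpow_neg_smul, zpow_one]
      rw [show ((h ^ n) ^ (2 : ℤ)) = h ^ (2 * n) by rw [mul_comm, pow_mul]; norm_cast]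
      linarith
    · intro l
      simp only [dist_zpow_smul]
      push_cast
      rw [show i + (l + 1) - (i + l : ℤ) = 1 by ring, zpow_one]
      linarith
  have hn0 : (0 : ℤ) < n := by exact_mod_cast hn
  have hdiv : ∀ i : ℤ, dist (h ^ i • x) ((h ^ n) ^ (i / n) • x) ≤ n * σ := by
    intro i
    rw [← zpow_natCast h n, ← zpow_mul, dist_comm, dist_zpow_smul]
    refine (dist_zpow_smul_le h x _).trans ?_
    have e : i - n * (i / n) = i % n := by have := Int.emod_add_mul_ediv i n; linarith
    rw [e]
    have h1 := Int.emod_nonneg i hn0.ne'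
    have h2 := (Int.emod_lt_of_pos i hn0).le
    have h3 : |((i % n : ℤ) : ℝ)| ≤ n := by
      rw [abs_of_nonneg (by exact_mod_cast h1)]; exact_mod_cast h2
    gcongr
  refine ⟨K, A + 2 * δ + 3 * (n * σ) + C, hK, by positivity, fun i j k hij hjk => ?_,
    fun i j => ?_⟩
  · have t := hH (i / n) (j / n) (k / n) (Int.ediv_le_ediv hn0 hij) (Int.ediv_le_ediv hn0 hjk)
    have t1 := gromovProduct_le_add_base (h ^ j • x) ((h ^ n) ^ (j / n) • x) (h ^ i • x)
      (h ^ k • x)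
    have t2 := gromovProduct_le_add_left ((h ^ n) ^ (j / n) • x) (h ^ i • x)
      ((h ^ n) ^ (i / n) • x) (h ^ k • x)
    have t3 := gromovProduct_le_add_right ((h ^ n) ^ (j / n) • x) ((h ^ n) ^ (i / n) • x)
      (h ^ k • x) ((h ^ n) ^ (k / n) • x)
    have := hdiv i
    have := hdiv j
    have := hdiv k
    linarith
  · have := (hq i j).1
    have : 0 ≤ A + 2 * δ + 3 * (n * σ) := by positivity
    linarith

/-- A point near a geodesic between two orbit points is near an orbit point between them. -/
theorem IsQuasiAxis.exists_dist_le {δ : ℝ} (hδ : IsHyperbolicWith X δ) {h : Γ} {x : X} {K C : ℝ}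
    (H : IsQuasiAxis h x K C) {q : X} {a b : ℤ} {C' : ℝ}
    (hq : gromovProduct q (h ^ a • x) (h ^ b • x) ≤ C') :
    ∃ j ∈ Set.uIcc a b, dist q (h ^ j • x) ≤ dist x (h • x) + 2 * C + 4 * C' + 2 * δ := by
  have hC' := (gromovProduct_nonneg _ _ _).trans hq
  have hC := H.nonneg
  -- Truncated because `q` may lie slightly beyond the end of the segment.
  set v := min (dist (h ^ a • x) q) (dist (h ^ a • x) (h ^ b • x)) with hv
  obtain ⟨j, hj, hjv⟩ := exists_mem_uIcc_abs_sub_le (f := fun j => dist (h ^ a • x) (h ^ j • x))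
    (σ := dist x (h • x)) (v := v) (a := a) (b := b) (fun i => by
      rw [← dist_zpow_succ_smul h x i, dist_comm (h ^ i • x)]
      exact (abs_dist_sub_le _ _ _).trans_eq' (by rw [dist_comm (h ^ a • x), dist_comm (h ^ a • x)]))
    (by
      simp only [dist_self]
      rw [Set.uIcc_of_le dist_nonneg]
      exact ⟨le_min dist_nonneg dist_nonneg, min_le_right _ _⟩)
  refine ⟨j, hj, ?_⟩
  have h1 := hδ.dist_le_of_near (M := C + C') (z := q) (z' := h ^ j • x) (x := h ^ a • x)
    (y := h ^ b • x) (by linarith) (by linarith [H.near_uIcc hj])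
  have h2 : |dist (h ^ a • x) q - v| ≤ 2 * C' := by
    rw [abs_of_nonneg (sub_nonneg.2 (min_le_left _ _))]
    have := dist_nonneg (x := h ^ b • x) (y := q)
    simp only [gromovProduct, dist_comm q] at *
    rcases min_cases (dist (h ^ a • x) q) (dist (h ^ a • x) (h ^ b • x)) with ⟨h3, -⟩ | ⟨h3, -⟩ <;>
      rw [hv, h3] <;> linarith
  have h3 := abs_sub_le (dist (h ^ a • x) q) v (dist (h ^ a • x) (h ^ j • x))
  rw [abs_sub_comm v] at h3
  linarith

/-- Orbit segments with nearby ends fellow-travel. -/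
theorem IsQuasiAxis.exists_dist_le_of_ends {δ : ℝ} (hδ : IsHyperbolicWith X δ) {h : Γ} {x : X}
    {K C R : ℝ} (H : IsQuasiAxis h x K C) {g : Γ} {i j i' j' m : ℤ}
    (hi : dist (g • h ^ i' • x) (h ^ i • x) ≤ R) (hj : dist (g • h ^ j' • x) (h ^ j • x) ≤ R)
    (hm : m ∈ Set.uIcc i' j') : ∃ k ∈ Set.uIcc i j, dist (g • h ^ m • x) (h ^ k • x) ≤
      dist x (h • x) + 6 * C + 8 * R + 2 * δ := by
  have h1 := H.near_uIcc hm
  rw [← gromovProduct_smul_smul g] at h1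
  have h2 := gromovProduct_le_add_left (g • h ^ m • x) (h ^ i • x) (g • h ^ i' • x) (h ^ j • x)
  have h3 := gromovProduct_le_add_right (g • h ^ m • x) (g • h ^ i' • x) (h ^ j • x)
    (g • h ^ j' • x)
  rw [dist_comm] at hi hj
  obtain ⟨k, hk, h4⟩ := H.exists_dist_le hδ (q := g • h ^ m • x) (a := i) (b := j)
    (C' := C + 2 * R) (by linarith)
  exact ⟨k, hk, by linarith⟩

theorem IsQuasiAxis.exists_isAttractor [GromovHyperbolicSpace X] {h : Γ} {x : X} {K C : ℝ}
    (H : IsQuasiAxis h x K C) : ∃ ξ : GromovBoundary X, IsAttractor X h ξ := by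
  refine ⟨Quotient.mk _ ⟨_, H.isGromovSequence⟩, fun y => ?_⟩
  have d1 : ∀ n : ℕ, dist (h ^ n • y) (h ^ n • x) = dist y x := fun n => dist_smul _ _ _
  have hy : IsGromovSequence (fun n : ℕ => h ^ n • y) := by
    intro o
    refine tendsto_atTop.2 fun b => ?_
    filter_upwards [tendsto_atTop.1 (H.isGromovSequence o) (b + 2 * dist y x)] with p hp
    have h1 := gromovProduct_le_add_left o (h ^ p.1 • x) (h ^ p.1 • y) (h ^ p.2 • x)
    have h2 := gromovProduct_le_add_right o (h ^ p.1 • y) (h ^ p.2 • x) (h ^ p.2 • y)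
    rw [dist_comm, d1] at h1 h2
    linarith
  refine ⟨hy, Quotient.sound fun o => ?_⟩
  refine tendsto_atTop.2 fun b => ?_
  filter_upwards [tendsto_atTop.1 ((H.isGromovSequence o).comp
    (tendsto_atTop_diagonal : Tendsto (fun n : ℕ => (n, n)) atTop atTop)) (b + dist y x)] with n hn
  have h1 := gromovProduct_le_add_left o (h ^ n • x) (h ^ n • y) (h ^ n • x)
  rw [dist_comm, d1] at h1
  simp only [Function.comp] at hn
  linarith

theorem ConvergesToBoundary.equiv_smul [GromovHyperbolicSpace X] {u : ℕ → X} {ξ : GromovBoundary X}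
    (hu : ConvergesToBoundary u ξ) {s : Γ} (hs : s • ξ = ξ) :
    GromovSequenceEquiv (fun n => s • u n) u := by
  obtain ⟨hu, rfl⟩ := hu
  exact Quotient.exact hs

/-- The elements of the stabilizer of the endpoints move the orbit of `x` uniformly little. -/
theorem IsQuasiAxis.exists_dist_le_of_mem_endpointStabilizer [GromovHyperbolicSpace X] {δ : ℝ}
    (h0 : 0 ≤ δ) (hδ : IsHyperbolicWith X δ) {h : Γ} {x : X} {K C : ℝ} (H : IsQuasiAxis h x K C) :
    ∃ R : ℝ, 0 ≤ R ∧ ∀ s ∈ endpointStabilizer X h, ∀ i : ℤ, ∃ j : ℤ,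
      dist (s • h ^ i • x) (h ^ j • x) ≤ R := by
  refine ⟨max 0 (dist x (h • x) + 2 * C + 4 * (C + 2 * δ) + 2 * δ), le_max_left _ _,
    fun s hs i => ?_⟩
  obtain ⟨ξ, hξ⟩ := H.exists_isAttractor
  obtain ⟨η, hη⟩ := H.inv.exists_isAttractor
  -- As `s` fixes both endpoints, far orbit points and their images under `s` look alike from `s • h
  -- ^ i • x`. So this point, which lies between the images, is near a geodesic between the orbit
  -- points themselves, with a bound independent of `s` and `i`.
  have e1 := (hξ x).equiv_smul (hs ⟨ξ, Or.inr hξ⟩) (s • h ^ i • x)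
  have e2 := (hη x).equiv_smul (hs ⟨η, Or.inl hη⟩) (s • h ^ i • x)
  obtain ⟨n, hn1, hn2, hn3⟩ := ((tendsto_atTop.1 e1 (C + 2 * δ + 1)).and
    ((tendsto_atTop.1 e2 (C + 2 * δ + 1)).and (eventually_ge_atTop i.natAbs))).exists
  have h1 := H.near (-n) i n (by omega) (by omega)
  rw [← gromovProduct_smul_smul s, zpow_natCast, zpow_neg, zpow_natCast, ← inv_pow] at h1
  have h2 : gromovProduct (s • h ^ i • x) (s • h⁻¹ ^ n • x) (h ^ n • x) ≤ C + δ := by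
    rcases hδ.le_or_le (s • h ^ i • x) (s • h⁻¹ ^ n • x) (h ^ n • x) (s • h ^ n • x) with hle | hle
    · linarith
    · rw [gromovProduct_comm] at hle
      linarith
  have h3 : gromovProduct (s • h ^ i • x) (h⁻¹ ^ n • x) (h ^ n • x) ≤ C + 2 * δ := by
    rcases hδ.le_or_le (s • h ^ i • x) (s • h⁻¹ ^ n • x) (h⁻¹ ^ n • x) (h ^ n • x) with hle | hle <;>
      linarith
  rw [inv_pow, ← zpow_natCast h n, ← zpow_neg] at h3
  obtain ⟨j, -, hj⟩ := H.exists_dist_le hδ h3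
  exact ⟨j, hj.trans (le_max_right _ _)⟩

end Orbit

/-! ## Overlaps between translates of the axis of a WWPD element -/

section Overlap

variable {Γ : Type*} [Group Γ] {X : Type*} [MetricSpace X] [MulAction Γ X]

/-- `g` maps the orbit of `x` under the powers of `h` into a bounded neighbourhood of itself. -/
def QuasiPreservesOrbit (h : Γ) (x : X) (g : Γ) : Prop :=
  ∃ R : ℝ, ∀ i : ℤ, ∃ j : ℤ, dist (g • h ^ i • x) (h ^ j • x) ≤ R

theorem quasiPreservesOrbit_zpow (h : Γ) (x : X) (n : ℤ) : QuasiPreservesOrbit h x (h ^ n) :=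
  ⟨0, fun i => ⟨n + i, by rw [zpow_add, mul_smul, dist_self]⟩⟩

variable [IsIsometricSMul Γ X]

theorem QuasiPreservesOrbit.mul {h : Γ} {x : X} {g g' : Γ} (hg : QuasiPreservesOrbit h x g)
    (hg' : QuasiPreservesOrbit h x g') : QuasiPreservesOrbit h x (g * g') := by
  obtain ⟨R, hR⟩ := hg
  obtain ⟨R', hR'⟩ := hg'
  refine ⟨R' + R, fun i => ?_⟩
  obtain ⟨j, hj⟩ := hR' i
  obtain ⟨k, hk⟩ := hR j
  refine ⟨k, ?_⟩
  rw [mul_smul]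
  refine (dist_triangle _ (g • h ^ j • x) _).trans (add_le_add ?_ hk)
  rwa [dist_smul]

/-- The elements that coarsely preserve the orbit of `x` under the powers of `h`. -/
def axisStabilizer (h : Γ) (x : X) : Subgroup Γ where
  carrier := {g | QuasiPreservesOrbit h x g ∧ QuasiPreservesOrbit h x g⁻¹}
  one_mem' := by
    have := quasiPreservesOrbit_zpow h x 0
    simpa using this
  mul_mem' := by
    rintro a b ⟨ha, ha'⟩ ⟨hb, hb'⟩
    refine ⟨ha.mul hb, ?_⟩
    rw [mul_inv_rev]
    exact hb'.mul ha'
  inv_mem' := by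
    rintro a ⟨ha, ha'⟩
    exact ⟨ha', by rwa [inv_inv]⟩

theorem zpow_mem_axisStabilizer (h : Γ) (x : X) (n : ℤ) : h ^ n ∈ axisStabilizer h x :=
  ⟨quasiPreservesOrbit_zpow h x n, by rw [← zpow_neg]; exact quasiPreservesOrbit_zpow h x (-n)⟩

/-- The elements `g` such that `g • x` is near `x` and the images under `g` of two long orbit
segments, one in each direction, end near the orbit; `ε = ±1` records a direction. -/
def overlapSet (h : Γ) (x : X) (R : ℝ) (ε : ℤ) (L : ℕ) : Set Γ :=
  {g | dist (g • x) x ≤ R ∧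
    (∃ c' c : ℤ, L ≤ c' ∧ 0 ≤ ε * c ∧ dist (g • h ^ c' • x) (h ^ c • x) ≤ R) ∧
    ∃ d' d : ℤ, d' ≤ -L ∧ dist (g • h ^ d' • x) (h ^ d • x) ≤ R}

omit [IsIsometricSMul Γ X] in
theorem overlapSet_anti (h : Γ) (x : X) (R : ℝ) (ε : ℤ) {L L' : ℕ} (hL : L ≤ L') :
    overlapSet h x R ε L' ⊆ overlapSet h x R ε L := by
  rintro g ⟨h1, ⟨c', c, h2, h3⟩, ⟨d', d, h4, h5⟩⟩
  exact ⟨h1, ⟨c', c, by omega, h3⟩, ⟨d', d, by omega, h5⟩⟩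

/-- Both images of `h ^ M • x` are near orbit points on the side of `x` given by `ε`, at nearly
equal distance from `x`. Hence `g₁⁻¹ * g₂` moves `x` and `h ^ M • x` little, as the WWPD condition
requires. -/
theorem dist_smul_zpow_smul_le {δ : ℝ} (hδ : IsHyperbolicWith X δ) {h : Γ} {x : X}
    {K C : ℝ} (H : IsQuasiAxis h x K C) {R : ℝ} {ε : ℤ} (hε : ε = 1 ∨ ε = -1)
    {M : ℕ} {g₁ g₂ : Γ} (h₁ : g₁ ∈ overlapSet h x R ε M) (h₂ : g₂ ∈ overlapSet h x R ε M) :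
    dist (g₁ • h ^ M • x) (g₂ • h ^ M • x) ≤
      2 * R + 2 * C + 4 * (dist x (h • x) + 6 * C + 8 * R + 2 * δ) := by
  set R' := dist x (h • x) + 6 * C + 8 * R + 2 * δ
  have key : ∀ g ∈ overlapSet h x R ε M, ∃ k : ℤ, 0 ≤ ε * k ∧
      dist (g • h ^ M • x) (h ^ k • x) ≤ R' ∧
      |dist x (h ^ k • x) - dist x (h ^ M • x)| ≤ R + R' := by
    rintro g ⟨h1, ⟨c', c, h2, h3, h4⟩, -⟩
    obtain ⟨k, hk, hd⟩ := H.exists_dist_le_of_ends hδ (g := g) (i := 0) (i' := 0) (j := c)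
      (j' := c') (m := M) (by simpa using h1) h4
      (by rw [Set.uIcc_of_le (by omega)]; constructor <;> omega)
    rw [zpow_natCast] at hd
    refine ⟨k, ?_, hd, ?_⟩
    · rcases Set.mem_uIcc.1 hk with ⟨h5, h6⟩ | ⟨h5, h6⟩ <;> rcases hε with rfl | rfl <;> omega
    · have e : dist (g • x) (g • h ^ M • x) = dist x (h ^ M • x) := dist_smul _ _ _
      have t1 := dist_triangle x (g • x) (h ^ k • x)
      have t2 := dist_triangle (g • x) (g • h ^ M • x) (h ^ k • x)
      have t3 := dist_triangle (g • x) x (g • h ^ M • x)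
      have t4 := dist_triangle x (h ^ k • x) (g • h ^ M • x)
      rw [dist_comm x (g • x)] at t1
      rw [dist_comm (h ^ k • x)] at t4
      rw [abs_le]; constructor <;> linarith
  have near : ∀ k l : ℤ, k ∈ Set.uIcc 0 l →
      dist (h ^ k • x) (h ^ l • x) ≤ dist x (h ^ l • x) - dist x (h ^ k • x) + 2 * C := by
    intro k l hk
    have := H.near_uIcc hk
    simp only [gromovProduct, zpow_zero, one_smul] at this
    rw [dist_comm (h ^ l • x) (h ^ k • x)] at this
    linarith
  obtain ⟨k, hk1, hk2, hk3⟩ := key g₁ h₁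
  obtain ⟨l, hl1, hl2, hl3⟩ := key g₂ h₂
  have hkl : dist (h ^ k • x) (h ^ l • x) ≤ 2 * (R + R') + 2 * C := by
    rw [abs_le] at hk3 hl3
    have : k ∈ Set.uIcc 0 l ∨ l ∈ Set.uIcc 0 k := by
      simp only [Set.mem_uIcc]
      rcases hε with rfl | rfl <;> omega
    rcases this with h | h
    · have := near k l h; linarith
    · have := near l k h; rw [dist_comm] at this; linarith
  have t1 := dist_triangle (g₁ • h ^ M • x) (h ^ k • x) (g₂ • h ^ M • x)
  have t2 := dist_triangle (h ^ k • x) (h ^ l • x) (g₂ • h ^ M • x)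
  rw [dist_comm (h ^ l • x)] at t2
  linarith

variable [GromovHyperbolicSpace X]

/-- WWPD is applied to coset representatives, after translating by the inverse of one fixed element
of the overlap set. -/
theorem IsWWPD.exists_finite_image_overlapSet {δ : ℝ} (hδ : IsHyperbolicWith X δ) {h : Γ}
    (hh : IsWWPD X h) {x : X} {K C : ℝ} (H : IsQuasiAxis h x K C) (R : ℝ) :
    ∃ L : ℕ, ∀ ε : ℤ, ε = 1 ∨ ε = -1 →
      ((fun g : Γ => (g : Γ ⧸ endpointStabilizer X h)) '' overlapSet h x R ε L).Finite := by
  set R₃ := 2 * R + 2 * C + 4 * (dist x (h • x) + 6 * C + 8 * R + 2 * δ)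
  obtain ⟨M, hM1, hM⟩ := hh.2 x (max (2 * R) R₃ ⊔ 0 + 1) (by positivity)
  refine ⟨M, fun ε hε => ?_⟩
  rcases (overlapSet h x R ε M).eq_empty_or_nonempty with he | ⟨k, hk⟩
  · simp [he]
  set π := fun g : Γ => (g : Γ ⧸ endpointStabilizer X h)
  obtain ⟨Z, hZ, hbij⟩ := Set.exists_subset_bijOn ((fun g => k⁻¹ * g) '' overlapSet h x R ε M) π
  have hfin : Z.Finite := by
    refine hM Z (fun g hg => ?_) hbij.injOn
    obtain ⟨g', hg', rfl⟩ := hZ hg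
    have h1 := le_max_left (2 * R) R₃
    have h2 := le_max_right (2 * R) R₃
    have h3 := le_max_left (max (2 * R) R₃) 0
    constructor
    · rw [mul_smul, ← dist_smul k, smul_inv_smul]
      have := dist_triangle_right (k • x) (g' • x) x
      have := hk.1
      have := hg'.1
      linarith
    · rw [mul_smul, ← dist_smul k, smul_inv_smul]
      have := dist_smul_zpow_smul_le hδ H hε hk hg'
      linarith
  have h2 : (π '' ((fun g => k⁻¹ * g) '' overlapSet h x R ε M)).Finite := by
    rw [← hbij.image_eq]; exact hfin.image _
  refine (h2.image (fun q => k • q)).subset ?_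
  rintro _ ⟨g, hg, rfl⟩
  refine ⟨_, ⟨_, ⟨g, hg, rfl⟩, rfl⟩, ?_⟩
  simp only [π, MulAction.Quotient.smul_coe, smul_eq_mul, mul_inv_cancel_left]

/-- The overlap sets decrease with `L` and eventually meet only finitely many cosets; beyond some
`L`, every coset still met is met for all `L'`. -/
theorem IsWWPD.exists_forall_overlapSet {δ : ℝ} (hδ : IsHyperbolicWith X δ) {h : Γ}
    (hh : IsWWPD X h) {x : X} {K C : ℝ} (H : IsQuasiAxis h x K C) (R : ℝ) :
    ∃ L : ℕ, ∀ ε : ℤ, ε = 1 ∨ ε = -1 → ∀ g ∈ overlapSet h x R ε L, ∀ L' : ℕ,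
      ∃ k ∈ overlapSet h x R ε L', (k : Γ ⧸ endpointStabilizer X h) = g := by
  obtain ⟨L₀, hL₀⟩ := hh.exists_finite_image_overlapSet hδ H R
  have key : ∀ ε : ℤ, ε = 1 ∨ ε = -1 → ∀ᶠ L : ℕ in atTop, ∀ q ∈
      (fun g : Γ => (g : Γ ⧸ endpointStabilizer X h)) '' overlapSet h x R ε L₀,
      (∃ k ∈ overlapSet h x R ε L, (k : Γ ⧸ endpointStabilizer X h) = q) →
      ∀ L' : ℕ, ∃ k ∈ overlapSet h x R ε L', (k : Γ ⧸ endpointStabilizer X h) = q := by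
    intro ε hε
    rw [eventually_all_finite (hL₀ ε hε)]
    intro q hq
    by_cases hc : ∀ L' : ℕ, ∃ k ∈ overlapSet h x R ε L', (k : Γ ⧸ endpointStabilizer X h) = q
    · exact Eventually.of_forall fun L _ => hc
    · obtain ⟨L', hL'⟩ := not_forall.1 hc
      filter_upwards [eventually_ge_atTop L'] with L hL
      rintro ⟨k, hk, rfl⟩
      exact absurd ⟨k, overlapSet_anti h x R ε hL hk, rfl⟩ hL'
  obtain ⟨L, h1, h2, h3⟩ :=
    ((key 1 (Or.inl rfl)).and ((key (-1) (Or.inr rfl)).and (eventually_ge_atTop L₀))).exists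
  refine ⟨L, fun ε hε g hg => ?_⟩
  have hg' : (g : Γ ⧸ endpointStabilizer X h) ∈
      (fun g : Γ => (g : Γ ⧸ endpointStabilizer X h)) '' overlapSet h x R ε L₀ :=
    ⟨g, overlapSet_anti h x R ε h3 hg, rfl⟩
  rcases hε with rfl | rfl
  · exact h1 _ hg' ⟨g, hg, rfl⟩
  · exact h2 _ hg' ⟨g, hg, rfl⟩

/-- For each `i` there is `k` in the coset of `g` whose overlap is long enough to contain the point
in question: `k⁻¹ * g` stabilizes the endpoints, so `g • h ^ i • x` is near some `k • h ^ j • x`,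
which lies in the overlap. The final bound does not depend on `i`, although `k` does. -/
theorem IsWWPD.exists_quasiPreservesOrbit_of_mem_overlapSet {δ : ℝ} (h0 : 0 ≤ δ)
    (hδ : IsHyperbolicWith X δ) {h : Γ} (hh : IsWWPD X h) {x : X} {K C : ℝ}
    (H : IsQuasiAxis h x K C) (R : ℝ) :
    ∃ L : ℕ, ∀ ε : ℤ, ε = 1 ∨ ε = -1 → ∀ g ∈ overlapSet h x R ε L,
      QuasiPreservesOrbit h x g := by
  obtain ⟨L, hL⟩ := hh.exists_forall_overlapSet hδ H R
  obtain ⟨R₀, hR₀, hs⟩ := H.exists_dist_le_of_mem_endpointStabilizer h0 hδ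
  refine ⟨L, fun ε hε g hg => ⟨R₀ + (dist x (h • x) + 6 * C + 8 * R + 2 * δ), fun i => ?_⟩⟩
  have hK : 0 < K := by linarith [H.one_le]
  obtain ⟨L', hL'⟩ := exists_nat_ge (K * (dist (g • h ^ i • x) x + R₀ + R + C))
  obtain ⟨k, ⟨hk1, ⟨c', c, hc1, -, hc⟩, ⟨d', d, hd1, hd⟩⟩, hkg⟩ := hL ε hε g hg L'
  obtain ⟨j, hj⟩ := hs (k⁻¹ * g) (QuotientGroup.eq.1 hkg) i
  rw [mul_smul, ← dist_smul k, smul_inv_smul] at hj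
  have hjL : |(j : ℝ)| ≤ L' := by
    have t1 := dist_triangle (k • h ^ j • x) (g • h ^ i • x) (k • x)
    have t2 := dist_triangle (g • h ^ i • x) x (k • x)
    rw [dist_comm x (k • x)] at t2
    rw [dist_smul, dist_comm (k • h ^ j • x)] at t1
    have t3 := H.lower j 0
    simp only [Int.cast_zero, sub_zero, zpow_zero, one_smul] at t3
    have : |(j : ℝ)| / K ≤ dist (g • h ^ i • x) x + R₀ + R + C := by linarith
    rw [div_le_iff₀ hK] at this
    linarith
  have hjL' : |j| ≤ L' := by exact_mod_cast hjL
  rw [abs_le] at hjL'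
  obtain ⟨m, -, hm⟩ := H.exists_dist_le_of_ends hδ hd hc (m := j)
    (by rw [Set.uIcc_of_le (by omega)]; constructor <;> omega)
  exact ⟨m, (dist_triangle _ _ _).trans (add_le_add hj hm)⟩

theorem IsWWPD.exists_quasiPreservesOrbit_of_overlap {δ : ℝ} (h0 : 0 ≤ δ)
    (hδ : IsHyperbolicWith X δ) {h : Γ} (hh : IsWWPD X h) {x : X} {K C : ℝ}
    (H : IsQuasiAxis h x K C) (R : ℝ) :
    ∃ L : ℝ, ∀ (g : Γ) (i j i' j' : ℤ), dist (g • h ^ i' • x) (h ^ i • x) ≤ R →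
      dist (g • h ^ j' • x) (h ^ j • x) ≤ R → L ≤ dist (h ^ i' • x) (h ^ j' • x) →
      QuasiPreservesOrbit h x g := by
  set σ := dist x (h • x)
  set R₂ := σ + 6 * C + 8 * R + 2 * δ
  have hσ : 0 ≤ σ := dist_nonneg
  have hC := H.nonneg
  obtain ⟨L, hL⟩ := hh.exists_quasiPreservesOrbit_of_mem_overlapSet h0 hδ H R₂
  refine ⟨(2 * L + 2) * σ + 1, fun g i j i' j' hi hj hd => ?_⟩
  wlog hij : i' ≤ j' generalizing i j i' j'
  · exact this j i j' i' hj hi (by rwa [dist_comm]) (le_of_not_ge hij)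
  have hRR : R ≤ R₂ := by
    have := dist_nonneg.trans hi
    simp only [R₂]; linarith
  have hlen : 2 * (L : ℤ) + 2 ≤ j' - i' := by
    by_contra! hcon
    have h1 : ((j' - i' : ℤ) : ℝ) ≤ 2 * L + 2 := by exact_mod_cast hcon.le
    rw [dist_zpow_smul] at hd
    have h2 := dist_zpow_smul_le h x (j' - i')
    rw [abs_of_nonneg (by exact_mod_cast sub_nonneg.2 hij)] at h2
    have : ((j' - i' : ℤ) : ℝ) * σ ≤ (2 * L + 2) * σ := by gcongr
    linarith
  set m' := (i' + j') / 2
  obtain ⟨m, -, hm⟩ := H.exists_dist_le_of_ends hδ hi hj (m := m')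
    (by rw [Set.uIcc_of_le hij]; constructor <;> omega)
  have trans : ∀ k' k : ℤ, dist (g • h ^ k' • x) (h ^ k • x) ≤ R₂ →
      dist ((h ^ (-m) * g * h ^ m') • h ^ (k' - m') • x) (h ^ (k - m) • x) ≤ R₂ := by
    intro k' k hk
    rw [mul_smul, mul_smul, ← mul_smul (h ^ m'), ← zpow_add, sub_eq_neg_add k, zpow_add h (-m),
      mul_smul (h ^ (-m)), dist_smul, add_sub_cancel]
    exact hk
  have hg : QuasiPreservesOrbit h x (h ^ (-m) * g * h ^ m') := by
    -- Powers of `h` move the middle of the overlap to `x`. The sign records whether `g` keeps or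
    -- reverses the direction of the axis.
    refine hL (if 0 ≤ j - m then 1 else -1) (by split_ifs <;> simp) _ ⟨?_,
      ⟨j' - m', j - m, by omega, ?_, trans _ _ (hj.trans hRR)⟩,
      ⟨i' - m', i - m, by omega, trans _ _ (hi.trans hRR)⟩⟩
    · simpa using trans m' m hm
    · split_ifs <;> omega
  have := ((quasiPreservesOrbit_zpow h x m).mul hg).mul (quasiPreservesOrbit_zpow h x (-m'))
  simpa [mul_assoc] using this

/-- Translates of the axis of a WWPD element with a long overlap are coarsely equal. -/
theorem IsWWPD.exists_mem_axisStabilizer_of_overlap {δ : ℝ} (h0 : 0 ≤ δ)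
    (hδ : IsHyperbolicWith X δ) {h : Γ} (hh : IsWWPD X h) {x : X} {K C : ℝ}
    (H : IsQuasiAxis h x K C) (R : ℝ) :
    ∃ L : ℝ, ∀ (g : Γ) (i j i' j' : ℤ), dist (g • h ^ i' • x) (h ^ i • x) ≤ R →
      dist (g • h ^ j' • x) (h ^ j • x) ≤ R → L ≤ dist (h ^ i' • x) (h ^ j' • x) →
      g ∈ axisStabilizer h x := by
  obtain ⟨L, hL⟩ := hh.exists_quasiPreservesOrbit_of_overlap h0 hδ H R
  -- The overlap seen from `g⁻¹` may be shorter by `2 * R`.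
  refine ⟨L + 2 * R, fun g i j i' j' hi hj hd => ?_⟩
  have hR := dist_nonneg.trans hi
  refine ⟨hL g i j i' j' hi hj (by linarith), hL g⁻¹ i' j' i j ?_ ?_ ?_⟩
  · rwa [← dist_smul g, smul_inv_smul, dist_comm]
  · rwa [← dist_smul g, smul_inv_smul, dist_comm]
  · have t1 := dist_triangle (g • h ^ i' • x) (h ^ i • x) (g • h ^ j' • x)
    have t2 := dist_triangle (h ^ i • x) (h ^ j • x) (g • h ^ j' • x)
    rw [dist_comm (h ^ j • x)] at t2
    rw [dist_smul] at t1
    linarith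

omit [GromovHyperbolicSpace X] in
-- The constant depends on neither `g` nor its `R`: orbit points that are `R`-close but very far
-- away have a large Gromov product at `g • x`, so `R` drops out.
theorem QuasiPreservesOrbit.exists_dist_le {δ : ℝ} (h0 : 0 ≤ δ) (hδ : IsHyperbolicWith X δ) {h : Γ}
    {x : X} {K C : ℝ} (H : IsQuasiAxis h x K C) {g : Γ} (hg : QuasiPreservesOrbit h x g) :
    ∃ j : ℤ, dist (g • x) (h ^ j • x) ≤
      dist x (h • x) + 2 * C + 4 * (C + 2 * δ) + 2 * δ := by
  obtain ⟨R, hR⟩ := hg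
  have hK : 0 < K := by linarith [H.one_le]
  obtain ⟨n, hn⟩ := exists_nat_ge ((R + 2 * C + 2 * δ + 1) * K)
  rw [← le_div_iff₀ hK] at hn
  obtain ⟨a, ha⟩ := hR (-n)
  obtain ⟨b, hb⟩ := hR n
  have far : ∀ k l : ℤ, |(k : ℝ)| = n → dist (g • h ^ k • x) (h ^ l • x) ≤ R →
      C + 2 * δ < gromovProduct (g • x) (g • h ^ k • x) (h ^ l • x) := by
    intro k l hk hkl
    have h1 := H.lower 0 k
    simp only [Int.cast_zero, zero_sub, abs_neg, hk, zpow_zero, one_smul] at h1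
    have h2 := gromovProduct_le_add_right (g • x) (g • h ^ k • x) (g • h ^ k • x) (h ^ l • x)
    have h3 : gromovProduct (g • x) (g • h ^ k • x) (g • h ^ k • x) = dist x (h ^ k • x) := by
      simp [gromovProduct, dist_comm]
    linarith
  have h1 := far (-n) a (by simp) ha
  have h2 := far n b (by simp) hb
  have h3 := H.near (-n) 0 n (by omega) (by omega)
  rw [← gromovProduct_smul_smul g, zpow_zero, one_smul] at h3
  have h4 : gromovProduct (g • x) (g • h ^ (-n : ℤ) • x) (h ^ b • x) ≤ C + δ := by
    rcases hδ.le_or_le (g • x) (g • h ^ (-n : ℤ) • x) (h ^ b • x) (g • h ^ (n : ℤ) • x) with hle | hle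
    · linarith
    · rw [gromovProduct_comm] at hle
      linarith
  have h5 : gromovProduct (g • x) (h ^ a • x) (h ^ b • x) ≤ C + 2 * δ := by
    rcases hδ.le_or_le (g • x) (g • h ^ (-n : ℤ) • x) (h ^ a • x) (h ^ b • x) with hle | hle <;>
      linarith
  obtain ⟨j, -, hj⟩ := H.exists_dist_le hδ h5
  exact ⟨j, hj⟩

omit [IsIsometricSMul Γ X] [GromovHyperbolicSpace X] in
theorem IsQuasiAxis.equiv_of_frequently {δ : ℝ} (h0 : 0 ≤ δ) (hδ : IsHyperbolicWith X δ) {h : Γ}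
    {x : X} {K C : ℝ} (H : IsQuasiAxis h x K C) {u : ℕ → X} (hu : IsGromovSequence u) {R : ℝ}
    (hf : ∀ N : ℕ, ∃ m ≥ N, ∃ j ≥ N, dist (u m) (h ^ j • x) ≤ R) :
    GromovSequenceEquiv u (fun n => h ^ n • x) := by
  intro o
  refine tendsto_atTop.2 fun b => ?_
  obtain ⟨⟨N₁, N₁'⟩, h1⟩ := eventually_atTop.1 (tendsto_atTop.1 (hu o) (b + 2 * δ + |R| + 1))
  obtain ⟨⟨N₂, N₂'⟩, h2⟩ :=
    eventually_atTop.1 (tendsto_atTop.1 (H.isGromovSequence o) (b + 2 * δ + 1))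
  filter_upwards [eventually_ge_atTop (N₁ + N₂)] with n hn
  obtain ⟨m, hm, j, hj, hmj⟩ := hf (N₁ + N₁' + N₂ + N₂')
  have a1 := h1 (n, m) ⟨by simp; omega, by simp; omega⟩
  have a2 := h2 (n, j) ⟨by simp; omega, by simp; omega⟩
  have a3 := gromovProduct_le_dist_right o (u n) (u m)
  have a4 := gromovProduct_le_add_right o (u m) (u m) (h ^ j • x)
  have a5 : gromovProduct o (u m) (u m) = dist (u m) o := by simp [gromovProduct]
  have a6 := le_abs_self R
  have a7 := abs_nonneg R
  simp only at a1 a2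
  rw [gromovProduct_comm] at a2
  by_contra! hcon
  rcases hδ.le_or_le o (u n) (h ^ j • x) (h ^ n • x) with hle | hle
  · rcases hδ.le_or_le o (u n) (u m) (h ^ j • x) with hle' | hle' <;> linarith
  · linarith

omit [GromovHyperbolicSpace X] in
-- The exponents `j n` tend to infinity in absolute value. Either infinitely many are nonnegative or
-- almost all are negative, and coming close infinitely often suffices for equivalence.
theorem IsQuasiAxis.equiv_or_equiv {δ : ℝ} (h0 : 0 ≤ δ) (hδ : IsHyperbolicWith X δ) {h g : Γ}
    {x : X} {K C K' C' : ℝ} (H : IsQuasiAxis h x K C) (H' : IsQuasiAxis g x K' C') {R : ℝ}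
    (hR : ∀ n : ℕ, ∃ j : ℤ, dist (g ^ n • x) (h ^ j • x) ≤ R) :
    GromovSequenceEquiv (fun n => g ^ n • x) (fun n => h ^ n • x) ∨
      GromovSequenceEquiv (fun n => g ^ n • x) (fun n => h⁻¹ ^ n • x) := by
  have hK' : 0 < K' := by linarith [H'.one_le]
  choose j hj using hR
  have large : ∀ N : ℕ, ∃ m₀ : ℕ, ∀ m ≥ m₀, (N : ℤ) ≤ |j m| := by
    intro N
    obtain ⟨m₀, hm₀⟩ := exists_nat_ge ((N * dist x (h • x) + R + C' + 1) * K')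
    refine ⟨m₀, fun m hm => ?_⟩
    by_contra! hcon
    have h1 := H'.lower 0 m
    simp only [Int.cast_zero, Int.cast_natCast, zero_sub, abs_neg, Nat.abs_cast, zpow_zero, one_smul,
      zpow_natCast] at h1
    have h2 := dist_zpow_smul_le h x (j m)
    have h3 : |(j m : ℝ)| ≤ N := by exact_mod_cast hcon.le
    have h4 : |(j m : ℝ)| * dist x (h • x) ≤ N * dist x (h • x) := by gcongr
    have h5 := dist_triangle_right x (g ^ m • x) (h ^ j m • x)
    have h6 : (m₀ : ℝ) ≤ m := by exact_mod_cast hm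
    have h7 : N * dist x (h • x) + R + C' + 1 ≤ m / K' := by
      rw [le_div_iff₀ hK']; linarith
    have := hj m
    linarith
  by_cases hc : ∀ N : ℕ, ∃ m ≥ N, 0 ≤ j m
  · left
    refine H.equiv_of_frequently h0 hδ H'.isGromovSequence (R := R) fun N => ?_
    obtain ⟨m₀, hm₀⟩ := large N
    obtain ⟨m, hm, hjm⟩ := hc (max N m₀)
    have h1 := hm₀ m (le_of_max_le_right hm)
    rw [abs_of_nonneg hjm] at h1
    refine ⟨m, le_of_max_le_left hm, (j m).toNat, by omega, ?_⟩
    rw [← zpow_natCast h, Int.toNat_of_nonneg hjm]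
    exact hj m
  · right
    push Not at hc
    obtain ⟨N₀, hN₀⟩ := hc
    refine H.inv.equiv_of_frequently h0 hδ H'.isGromovSequence (R := R) fun N => ?_
    obtain ⟨m₀, hm₀⟩ := large N
    set m := max N (max m₀ N₀)
    have hjm := hN₀ m ((le_max_right _ _).trans (le_max_right _ _))
    have h1 := hm₀ m ((le_max_left _ _).trans (le_max_right _ _))
    rw [abs_of_neg hjm] at h1
    refine ⟨m, le_max_left _ _, (-j m).toNat, by omega, ?_⟩
    rw [← zpow_natCast h⁻¹, Int.toNat_of_nonneg (by omega), inv_zpow, zpow_neg, inv_inv]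
    exact hj m

/-- If there are independent loxodromic elements, then some element does not coarsely preserve the
axis of `h`. -/
theorem IndependentLoxodromics.exists_notMem_axisStabilizer {δ : ℝ} (h1 : 1 ≤ δ)
    (hδ : IsHyperbolicWith X δ) {h g₁ g₂ : Γ} {x : X} {K C : ℝ} (H : IsQuasiAxis h x K C)
    (hg : IndependentLoxodromics X g₁ g₂) : ∃ t : Γ, t ∉ axisStabilizer h x := by
  have h0 : 0 ≤ δ := by linarith
  by_contra! hall
  have hR : ∀ g : Γ, ∀ n : ℕ, ∃ j : ℤ, dist (g ^ n • x) (h ^ j • x) ≤ _ :=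
    fun g n => QuasiPreservesOrbit.exists_dist_le h0 hδ H (hall (g ^ n)).1
  obtain ⟨hg₁, hg₂, hdisj⟩ := hg
  obtain ⟨K₁, C₁, H₁⟩ := hg₁.exists_isQuasiAxis h1 hδ x
  obtain ⟨K₂, C₂, H₂⟩ := hg₂.exists_isQuasiAxis h1 hδ x
  obtain ⟨ξ₁, hξ₁⟩ := H₁.exists_isAttractor
  obtain ⟨η₁, hη₁⟩ := H₁.inv.exists_isAttractor
  obtain ⟨ξ₂, hξ₂⟩ := H₂.exists_isAttractor
  have cls : ∀ {g : Γ} {K' C' : ℝ} {ζ : GromovBoundary X}, IsQuasiAxis g x K' C' →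
      IsAttractor X g ζ → ζ = Quotient.mk _ ⟨_, H.isGromovSequence⟩ ∨
        ζ = Quotient.mk _ ⟨_, H.inv.isGromovSequence⟩ := by
    intro g K' C' ζ Hg hζ
    obtain ⟨hu, rfl⟩ := hζ x
    rcases H.equiv_or_equiv h0 hδ Hg (hR g) with h | h
    · exact Or.inl (Quotient.sound h)
    · exact Or.inr (Quotient.sound h)
  have hne : ξ₁ ≠ η₁ := by
    rintro rfl
    obtain ⟨hu, e1⟩ := hξ₁ x
    obtain ⟨hv, e2⟩ := hη₁ x
    have e : GromovSequenceEquiv (fun n => g₁ ^ n • x) (fun n => g₁⁻¹ ^ n • x) :=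
      Quotient.exact (e1.trans e2.symm)
    obtain ⟨n, hn⟩ := (tendsto_atTop.1 (e x) (C₁ + 1)).exists
    have h2 := H₁.near (-n) 0 n (by omega) (by omega)
    rw [gromovProduct_comm] at h2
    simp only [zpow_zero, one_smul, zpow_natCast, zpow_neg, inv_pow] at *
    linarith
  -- All endpoints are among the two ends of the orbit of `h`, and `ξ₁ ≠ η₁` already exhaust them.
  have h2 : ξ₂ = ξ₁ ∨ ξ₂ = η₁ := by
    rcases cls H₁ hξ₁ with e1 | e1 <;> rcases cls H₁.inv hη₁ with e2 | e2 <;>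
      rcases cls H₂ hξ₂ with e3 | e3 <;> grind
  have hmem : ξ₂ ∈ boundaryEndpoints X g₁ := by
    rcases h2 with rfl | rfl
    · exact Or.inr hξ₁
    · exact Or.inl hη₁
  exact Set.disjoint_left.1 hdisj hmem (Or.inr hξ₂)

end Overlap

/-! ## Words that run along several translates of the axis -/

section Words

variable {Γ : Type*} [Group Γ]

/-- The exponents of `h` in the word, up to a common factor. -/
def wordExp (j : ℕ) : ℤ :=
  -- The sum is 0, which kills homomorphisms. The absolute value 7 dominates, and its neighbours 4
  -- and 2 differ, which reveals the direction.
  if j % 4 = 0 then 1 else if j % 4 = 1 then 4 else if j % 4 = 2 then -7 else 2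

/-- The letters `h ^ N t`, `h ^ (4 N) t⁻¹`, `h ^ (-7 N) t`, `h ^ (2 N) t⁻¹`, repeated
periodically. -/
def axisLetter (h t : Γ) (N j : ℕ) : Γ :=
  h ^ (wordExp j * N) * if j % 2 = 0 then t else t⁻¹

/-- The product of the first `j` letters. -/
def axisWord (h t : Γ) (N : ℕ) : ℕ → Γ
  | 0 => 1
  | j + 1 => axisWord h t N j * axisLetter h t N j

/-- One period of the word. -/
def periodWord (h t : Γ) (N : ℕ) : Γ := axisWord h t N 4

theorem axisLetter_add_four (h t : Γ) (N j : ℕ) :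
    axisLetter h t N (4 + j) = axisLetter h t N j := by
  have h1 : (4 + j) % 4 = j % 4 := by omega
  have h2 : (4 + j) % 2 = j % 2 := by omega
  simp only [axisLetter, wordExp, h1, h2]

theorem axisWord_four_add (h t : Γ) (N j : ℕ) :
    axisWord h t N (4 + j) = periodWord h t N * axisWord h t N j := by
  induction j with
  | zero => simp [axisWord, periodWord]
  | succ j ih =>
    rw [← add_assoc, axisWord, ih, axisLetter_add_four, axisWord, mul_assoc]

theorem axisWord_add_four_mul (h t : Γ) (N k j : ℕ) :
    axisWord h t N (4 * k + j) = periodWord h t N ^ k * axisWord h t N j := by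
  induction k with
  | zero => simp
  | succ k ih =>
    rw [show 4 * (k + 1) + j = 4 + (4 * k + j) by ring, axisWord_four_add, ih, pow_succ', mul_assoc]

theorem axisWord_four_mul (h t : Γ) (N k : ℕ) :
    axisWord h t N (4 * k) = periodWord h t N ^ k := by
  simpa [axisWord] using axisWord_add_four_mul h t N k 0

/-- Homomorphisms to `ℝ` vanish on `periodWord`. -/
theorem map_periodWord {φ : Γ → ℝ} (hφ : ∀ a b, φ (a * b) = φ a + φ b) (h t : Γ) (N : ℕ) :
    φ (periodWord h t N) = 0 := by
  let ψ : Γ →* Multiplicative ℝ := MonoidHom.mk' (fun g => Multiplicative.ofAdd (φ g))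
    fun a b => by simp [hφ]
  have h1 : ∀ g, φ g = Multiplicative.toAdd (ψ g) := fun g => rfl
  rw [h1]
  simp only [periodWord, axisWord, axisLetter, wordExp]
  simp
  ring

end Words

/-! ### Word axes as quasigeodesics, and `h`-segments running along them -/

section WordAxis

theorem gromovProduct_le_of_close {X : Type*} [MetricSpace X] {x y z w : X} {M : ℝ} {c : ℝ}
    (h : gromovProduct w y z ≤ M) (hd : dist x w ≤ c) : gromovProduct x y z ≤ M + c := by
  have := gromovProduct_le_add_base x w y z
  linarith

variable {Γ : Type*} [Group Γ] {X : Type*} [MetricSpace X] [MulAction Γ X] [IsIsometricSMul Γ X]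

/-- Translates of the axis of `h` overlap boundedly unless they are coarsely equal. -/
def HasBoundedOverlaps (h : Γ) (x : X) : Prop :=
  ∀ R : ℝ, ∃ L : ℝ, ∀ (g : Γ) (i j i' j' : ℤ), dist (g • h ^ i' • x) (h ^ i • x) ≤ R →
    dist (g • h ^ j' • x) (h ^ j • x) ≤ R → L ≤ dist (h ^ i' • x) (h ^ j' • x) →
    g ∈ axisStabilizer h x

theorem axisLetter_notMem {h t : Γ} {x : X} (ht : t ∉ axisStabilizer h x) (N j : ℕ) :
    axisLetter h t N j ∉ axisStabilizer h x := by
  rw [axisLetter, Subgroup.mul_mem_cancel_left _ (zpow_mem_axisStabilizer h x _)]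
  split_ifs
  · exact ht
  · rwa [inv_mem_iff]

theorem abs_dist_zpow_succ_sub_le (h : Γ) (x y : X) (i : ℤ) :
    |dist y (h ^ (i + 1) • x) - dist y (h ^ i • x)| ≤ dist x (h • x) := by
  have := abs_dist_sub_le (h ^ (i + 1) • x) (h ^ i • x) y
  rwa [dist_comm _ y, dist_comm _ y, dist_comm (h ^ (i + 1) • x), dist_zpow_succ_smul] at this

/-- An orbit segment leaves the axis of `h` soon after a turn by `t`. -/
theorem IsQuasiAxis.exists_turn_bound {δ : ℝ} (h0 : 0 ≤ δ) (hδ : IsHyperbolicWith X δ) {h : Γ}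
    {x : X} {K C : ℝ} (H : IsQuasiAxis h x K C) (hov : HasBoundedOverlaps h x) {t : Γ}
    (ht : t ∉ axisStabilizer h x) :
    ∃ A : ℝ, ∀ p q : ℤ, gromovProduct x (t • h ^ p • x) (h ^ q • x) ≤ A := by
  set σ := dist x (h • x)
  set R := σ + 2 * C + 4 * (2 * σ + C + δ + dist x (t • x)) + 2 * δ
  have hσ : 0 ≤ σ := dist_nonneg
  have hC := H.nonneg
  have hT : 0 ≤ dist x (t • x) := dist_nonneg
  obtain ⟨L, hL⟩ := hov R
  refine ⟨L + σ, fun p q => ?_⟩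
  -- If the product `G` is large, an orbit point `h ^ i • x` at distance about `G` from `x` is also
  -- near the `t`-translate of the orbit. Together with `x` and `t • x` it bounds a long overlap,
  -- which puts `t` into the stabilizer.
  by_contra! hcon
  set G := gromovProduct x (t • h ^ p • x) (h ^ q • x)
  have hG : G ≤ dist x (h ^ q • x) :=
    (gromovProduct_le_dist_right _ _ _).trans_eq (dist_comm _ _)
  obtain ⟨i, hi, hiG⟩ := exists_mem_uIcc_abs_sub_le (f := fun i => dist x (h ^ i • x))
    (v := G) (a := 0) (b := q) (abs_dist_zpow_succ_sub_le h x x) (by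
      simp only [zpow_zero, one_smul, dist_self]
      rw [Set.uIcc_of_le dist_nonneg]
      exact ⟨gromovProduct_nonneg _ _ _, hG⟩)
  rw [abs_le] at hiG
  have h1 := H.near_uIcc hi
  rw [zpow_zero, one_smul] at h1
  have h2 := gromovProduct_add_gromovProduct x (h ^ i • x) (h ^ q • x)
  have h3 : G - σ - C - δ ≤ gromovProduct x (h ^ i • x) (t • h ^ p • x) := by
    rcases hδ.le_or_le x (h ^ i • x) (h ^ q • x) (t • h ^ p • x) with hle | hle
    · linarith
    · rw [gromovProduct_comm] at hle
      linarith
  have h4 := gromovProduct_add_gromovProduct x (h ^ i • x) (t • h ^ p • x)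
  have h5 := gromovProduct_le_add_left (h ^ i • x) (t • x) x (t • h ^ p • x)
  rw [← gromovProduct_smul_smul t⁻¹, inv_smul_smul, inv_smul_smul, dist_comm] at h5
  obtain ⟨j, -, hj⟩ := H.exists_dist_le hδ (q := t⁻¹ • h ^ i • x) (a := 0) (b := p)
    (C' := 2 * σ + C + δ + dist x (t • x)) (by rw [zpow_zero, one_smul]; linarith)
  refine ht ((inv_mem_iff (H := axisStabilizer h x)).1 (hL t⁻¹ j 0 i 0 hj ?_ ?_))
  · rw [zpow_zero, one_smul, ← dist_smul t, smul_inv_smul]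
    linarith
  · rw [zpow_zero, one_smul, dist_comm]
    linarith

/-- The broken line through the points `axisWord h t N j • x` is a quasigeodesic, whose pieces run
along translates of the axis of `h`. -/
structure IsWordAxis (h t : Γ) (x : X) (B c : ℝ) (N : ℕ) : Prop where
  near : ∀ i j k : ℕ, i ≤ j → j ≤ k → gromovProduct (axisWord h t N j • x)
    (axisWord h t N i • x) (axisWord h t N k • x) ≤ B
  step : ∀ j, |dist (axisWord h t N j • x) (axisWord h t N (j + 1) • x) -
    |(wordExp j : ℝ)| * dist x (h ^ N • x)| ≤ c
  piece : ∀ j, dist (axisWord h t N j • h ^ (wordExp j * N) • x) (axisWord h t N (j + 1) • x) ≤ c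

theorem IsQuasiAxis.abs_dist_pow_mul_sub_le {h : Γ} {x : X} {K C : ℝ} (H : IsQuasiAxis h x K C)
    (N k : ℕ) : |dist x (h ^ (k * N) • x) - k * dist x (h ^ N • x)| ≤ 2 * C * k := by
  induction k with
  | zero => simp
  | succ k ih =>
    have h1 := H.near 0 (k * N : ℕ) ((k + 1) * N : ℕ) (by positivity)
      (by exact_mod_cast Nat.mul_le_mul_right N (Nat.le_succ k))
    have h2 := gromovProduct_nonneg (h ^ ((k * N : ℕ) : ℤ) • x) (h ^ (0 : ℤ) • x)
      (h ^ (((k + 1) * N : ℕ) : ℤ) • x)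
    have h3 := dist_zpow_smul h x (k * N : ℕ) ((k + 1) * N : ℕ)
    rw [show (((k + 1) * N : ℕ) : ℤ) - (k * N : ℕ) = (N : ℕ) by push_cast; ring] at h3
    simp only [zpow_natCast, gromovProduct, zpow_zero, one_smul] at h1 h2 h3
    rw [dist_comm (h ^ ((k + 1) * N) • x), h3] at h1 h2
    rw [abs_le] at ih ⊢
    push_cast
    constructor <;> linarith

theorem IsQuasiAxis.abs_dist_wordExp_sub_le {h : Γ} {x : X} {K C : ℝ} (H : IsQuasiAxis h x K C)
    (N j : ℕ) :
    |dist x (h ^ (wordExp j * N) • x) - |(wordExp j : ℝ)| * dist x (h ^ N • x)| ≤ 14 * C := by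
  have key : ∀ k : ℕ, k ≤ 7 →
      |dist x (h ^ ((k : ℤ) * N) • x) - k * dist x (h ^ N • x)| ≤ 14 * C := by
    intro k hk
    have := H.abs_dist_pow_mul_sub_le N k
    rw [← Nat.cast_mul, zpow_natCast]
    have h1 : (k : ℝ) ≤ 7 := by exact_mod_cast hk
    nlinarith [H.nonneg]
  simp only [wordExp]
  split_ifs
  · simpa using key 1 (by norm_num)
  · simpa using key 4 (by norm_num)
  · rw [neg_mul, dist_zpow_neg_smul]
    simpa using key 7 (by norm_num)
  · simpa using key 2 (by norm_num)

theorem one_le_abs_wordExp (j : ℕ) : 1 ≤ |(wordExp j : ℝ)| := by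
  simp only [wordExp]
  split_ifs <;> norm_num

/-- The turn bounds for `t` and `t⁻¹` control the Gromov product at each vertex independently of
`N`, so the local-to-global principle applies once the pieces are long. That `B` and `c` do not
depend on `N` is essential: `W` is fixed before the words are chosen. -/
theorem IsQuasiAxis.exists_isWordAxis {δ : ℝ} (h1 : 1 ≤ δ) (hδ : IsHyperbolicWith X δ) {h : Γ}
    {x : X} {K C : ℝ} (H : IsQuasiAxis h x K C) (hov : HasBoundedOverlaps h x) {t : Γ}
    (ht : t ∉ axisStabilizer h x) :
    ∃ B c Λ : ℝ, 0 ≤ B ∧ 0 ≤ c ∧ ∀ N : ℕ, Λ ≤ dist x (h ^ N • x) → IsWordAxis h t x B c N := by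
  obtain ⟨A₁, hA₁⟩ := H.exists_turn_bound (by linarith) hδ hov ht
  obtain ⟨A₂, hA₂⟩ := H.exists_turn_bound (by linarith) hδ hov
    (t := t⁻¹) (by rwa [inv_mem_iff])
  set T := dist x (t • x)
  have hT : 0 ≤ T := dist_nonneg
  have hC := H.nonneg
  have hT' : dist x (t⁻¹ • x) = T := by rw [← dist_smul t, smul_inv_smul, dist_comm]
  set A := max (max A₁ A₂) 0 + T with hA
  have hA0 : 0 ≤ A := add_nonneg (le_max_right _ _) hT
  have hA1 : A₁ + T ≤ A := by
    have := (le_max_left A₁ A₂).trans (le_max_left _ 0); linarith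
  have hA2 : A₂ + T ≤ A := by
    have := (le_max_right A₁ A₂).trans (le_max_left _ 0); linarith
  have hpiece : ∀ N j : ℕ, dist (axisWord h t N j • h ^ (wordExp j * N) • x)
      (axisWord h t N (j + 1) • x) = T := by
    intro N j
    rw [axisWord, axisLetter, mul_smul, mul_smul, dist_smul, dist_smul]
    split_ifs
    · rfl
    · exact hT'
  have hstep : ∀ N j : ℕ, |dist (axisWord h t N j • x) (axisWord h t N (j + 1) • x) -
      |(wordExp j : ℝ)| * dist x (h ^ N • x)| ≤ 14 * C + T := by
    intro N j
    have e1 := hpiece N j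
    have e2 := H.abs_dist_wordExp_sub_le N j
    have e3 : dist (axisWord h t N j • x) (axisWord h t N j • h ^ (wordExp j * N) • x) =
      dist x (h ^ (wordExp j * N) • x) := dist_smul _ _ _
    have t1 := dist_triangle (axisWord h t N j • x) (axisWord h t N j • h ^ (wordExp j * N) • x)
      (axisWord h t N (j + 1) • x)
    have t2 := dist_triangle_right (axisWord h t N j • x)
      (axisWord h t N j • h ^ (wordExp j * N) • x) (axisWord h t N (j + 1) • x)
    rw [abs_le] at *
    constructor <;> linarith
  refine ⟨A + 2 * δ, 14 * C + T, 2 * A + 5 * δ + (14 * C + T), by linarith, by linarith,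
    fun N hN => ⟨fun i j k hij hjk => ?_, hstep N, fun j => by rw [hpiece]; linarith⟩⟩
  refine hδ.gromovProduct_le_of_local (v := fun j => axisWord h t N j • x) (by linarith) hA0
    (fun j => ?_) (fun j => ?_) hij hjk
  · have e : ∀ g : Γ, (axisWord h t N (j + 1))⁻¹ • g • x = ((axisWord h t N (j + 1))⁻¹ * g) • x :=
      fun g => (mul_smul _ _ _).symm
    rw [← gromovProduct_smul_smul (axisWord h t N (j + 1))⁻¹, inv_smul_smul, e, e,
      show (axisWord h t N (j + 1))⁻¹ * axisWord h t N (j + 2) = axisLetter h t N (j + 1) by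
        rw [show axisWord h t N (j + 2) = axisWord h t N (j + 1) * axisLetter h t N (j + 1) from rfl,
          inv_mul_cancel_left],
      show (axisWord h t N (j + 1))⁻¹ * axisWord h t N j = (axisLetter h t N j)⁻¹ by
        rw [axisWord]; group]
    have close : dist (axisLetter h t N (j + 1) • x) (h ^ (wordExp (j + 1) * N) • x) = T := by
      rw [axisLetter, mul_smul, dist_smul, dist_comm]
      split_ifs
      · rfl
      · exact hT'
    have h2 := gromovProduct_le_add_right x ((axisLetter h t N j)⁻¹ • x)
      (axisLetter h t N (j + 1) • x) (h ^ (wordExp (j + 1) * N) • x)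
    have h3 : gromovProduct x ((axisLetter h t N j)⁻¹ • x) (h ^ (wordExp (j + 1) * N) • x) ≤
        A - T := by
      rw [axisLetter, mul_inv_rev, mul_smul, ← zpow_neg]
      split_ifs
      · have := hA₂ (-(wordExp j * N)) (wordExp (j + 1) * N); linarith
      · rw [inv_inv]
        have := hA₁ (-(wordExp j * N)) (wordExp (j + 1) * N); linarith
    linarith
  · have h2 := (abs_le.1 (hstep N j)).1
    have h3 : 1 * dist x (h ^ N • x) ≤ |(wordExp j : ℝ)| * dist x (h ^ N • x) :=
      mul_le_mul_of_nonneg_right (one_le_abs_wordExp j) dist_nonneg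
    linarith

/-- Two translates of orbit segments that run along a common stretch of a geodesic. -/
theorem IsQuasiAxis.exists_overlap_bound {δ : ℝ} (hδ : IsHyperbolicWith X δ) {h : Γ}
    {x : X} {K C : ℝ} (H : IsQuasiAxis h x K C) (hov : HasBoundedOverlaps h x) (M : ℝ) :
    ∃ L : ℝ, ∀ (o y : X) (g₁ g₂ : Γ) (p₁ p₂ : ℤ),
      gromovProduct (g₁ • x) o y ≤ M → gromovProduct (g₁ • h ^ p₁ • x) o y ≤ M →
      gromovProduct (g₂ • x) o y ≤ M → gromovProduct (g₂ • h ^ p₂ • x) o y ≤ M →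
      ∀ s s' : ℝ, s ∈ Set.uIcc (dist o (g₁ • x)) (dist o (g₁ • h ^ p₁ • x)) →
        s' ∈ Set.uIcc (dist o (g₁ • x)) (dist o (g₁ • h ^ p₁ • x)) →
        s ∈ Set.uIcc (dist o (g₂ • x)) (dist o (g₂ • h ^ p₂ • x)) →
        s' ∈ Set.uIcc (dist o (g₂ • x)) (dist o (g₂ • h ^ p₂ • x)) →
        L ≤ |s - s'| → g₁⁻¹ * g₂ ∈ axisStabilizer h x := by
  set σ := dist x (h • x)
  obtain ⟨L, hL⟩ := hov (2 * σ + 2 * (M + 2 * C + 2 * δ) + 2 * δ)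
  refine ⟨L + 2 * σ, fun o y g₁ g₂ p₁ p₂ m₁ m₁' m₂ m₂' s s' hs₁ hs₁' hs₂ hs₂' hss => ?_⟩
  have find : ∀ (g : Γ) (p : ℤ), gromovProduct (g • x) o y ≤ M →
      gromovProduct (g • h ^ p • x) o y ≤ M → ∀ s : ℝ,
      s ∈ Set.uIcc (dist o (g • x)) (dist o (g • h ^ p • x)) → ∃ i : ℤ,
      |dist o (g • h ^ i • x) - s| ≤ σ ∧
        gromovProduct (g • h ^ i • x) o y ≤ M + 2 * C + 2 * δ := by
    intro g p m m' s hs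
    obtain ⟨i, hi, his⟩ := exists_mem_uIcc_abs_sub_le (f := fun i => dist o (g • h ^ i • x))
      (σ := σ) (v := s) (a := 0) (b := p) (fun i => by
        have := abs_dist_zpow_succ_sub_le h x (g⁻¹ • o) i
        rwa [← dist_smul g, smul_inv_smul, ← dist_smul g (g⁻¹ • o), smul_inv_smul] at this)
      (by simpa using hs)
    refine ⟨i, his, hδ.near_of_near m m' ?_⟩
    have := H.near_uIcc hi
    rwa [← gromovProduct_smul_smul g, zpow_zero, one_smul] at this
  have close : ∀ s : ℝ, s ∈ Set.uIcc (dist o (g₁ • x)) (dist o (g₁ • h ^ p₁ • x)) →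
      s ∈ Set.uIcc (dist o (g₂ • x)) (dist o (g₂ • h ^ p₂ • x)) → ∃ i i' : ℤ,
      dist ((g₁⁻¹ * g₂) • h ^ i' • x) (h ^ i • x) ≤
        2 * σ + 2 * (M + 2 * C + 2 * δ) + 2 * δ ∧ |dist o (g₂ • h ^ i' • x) - s| ≤ σ := by
    intro s hs₁ hs₂
    obtain ⟨i, hi, ni⟩ := find g₁ p₁ m₁ m₁' s hs₁
    obtain ⟨i', hi', ni'⟩ := find g₂ p₂ m₂ m₂' s hs₂
    refine ⟨i, i', ?_, hi'⟩
    rw [← dist_smul g₁, ← mul_smul, mul_inv_cancel_left]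
    have h1 := hδ.dist_le_of_near ni' ni
    have h2 : |dist o (g₂ • h ^ i' • x) - dist o (g₁ • h ^ i • x)| ≤ 2 * σ := by
      rw [abs_le] at *; constructor <;> linarith
    linarith
  obtain ⟨i, i', hi, hi'⟩ := close s hs₁ hs₂
  obtain ⟨j, j', hj, hj'⟩ := close s' hs₁' hs₂'
  refine hL _ i j i' j' hi hj ?_
  have h1 := abs_dist_sub_le (g₂ • h ^ i' • x) (g₂ • h ^ j' • x) o
  rw [dist_comm _ o, dist_comm _ o, dist_smul] at h1
  have h2 : |s - s'| ≤ |dist o (g₂ • h ^ i' • x) - dist o (g₂ • h ^ j' • x)| + 2 * σ := by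
    rw [abs_le] at hi' hj'
    have := le_abs_self (dist o (g₂ • h ^ i' • x) - dist o (g₂ • h ^ j' • x))
    have := neg_abs_le (dist o (g₂ • h ^ i' • x) - dist o (g₂ • h ^ j' • x))
    rw [abs_le]; constructor <;> linarith
  linarith

/-- The distance of the `j`-th vertex from the origin of the word axis. -/
noncomputable def wordCoord (h t : Γ) (x : X) (N j : ℕ) : ℝ := dist x (axisWord h t N j • x)

omit [IsIsometricSMul Γ X] in
theorem IsWordAxis.wordCoord_succ {h t : Γ} {x : X} {B c : ℝ} {N : ℕ}
    (w : IsWordAxis h t x B c N) (j : ℕ) :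
    wordCoord h t x N j + |(wordExp j : ℝ)| * dist x (h ^ N • x) - c - 2 * B ≤
      wordCoord h t x N (j + 1) ∧
    wordCoord h t x N (j + 1) ≤
      wordCoord h t x N j + |(wordExp j : ℝ)| * dist x (h ^ N • x) + c := by
  have h1 := abs_le.1 (w.step j)
  have h2 := w.near 0 j (j + 1) (by omega) (by omega)
  have h3 := gromovProduct_nonneg (axisWord h t N j • x) (axisWord h t N 0 • x)
    (axisWord h t N (j + 1) • x)
  have e : axisWord h t N 0 • x = x := one_smul _ _
  simp only [wordCoord, gromovProduct, e, dist_comm (axisWord h t N (j + 1) • x)] at *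
  constructor <;> linarith

theorem exists_le_lt_succ {s : ℕ → ℝ} {θ : ℝ} {n : ℕ} (h0 : s 0 ≤ θ) (hn : θ < s n) :
    ∃ j < n, s j ≤ θ ∧ θ < s (j + 1) := by
  induction n with
  | zero => linarith
  | succ n ih =>
    rcases lt_or_ge θ (s n) with h | h
    · obtain ⟨j, hj, h⟩ := ih h
      exact ⟨j, by omega, h⟩
    · exact ⟨n, by omega, h, hn⟩

/-- A translate of an orbit segment that runs along a word axis does not run past a turn. -/
theorem IsQuasiAxis.exists_no_turn_inside {δ : ℝ} (hδ : IsHyperbolicWith X δ) {h : Γ}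
    {x : X} {K C : ℝ} (H : IsQuasiAxis h x K C) (hov : HasBoundedOverlaps h x) {t : Γ}
    (ht : t ∉ axisStabilizer h x) {B c : ℝ} (hc : 0 ≤ c) (M : ℝ) :
    ∃ L : ℝ, 0 ≤ L ∧ ∀ N : ℕ, L ≤ dist x (h ^ N • x) → IsWordAxis h t x B c N →
      ∀ (n : ℕ) (g : Γ) (p : ℤ), gromovProduct (g • x) x (axisWord h t N n • x) ≤ M →
        gromovProduct (g • h ^ p • x) x (axisWord h t N n • x) ≤ M →
        max (dist x (g • x)) (dist x (g • h ^ p • x)) - L ≤ wordCoord h t x N n ∧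
        ∀ j ≤ n, wordCoord h t x N j ≤ min (dist x (g • x)) (dist x (g • h ^ p • x)) + L ∨
          max (dist x (g • x)) (dist x (g • h ^ p • x)) - L ≤ wordCoord h t x N j := by
  obtain ⟨L₀, hL₀⟩ := H.exists_overlap_bound hδ hov (max M (B + c))
  set L₁ := |L₀|
  have hL₁ : 0 ≤ L₁ := abs_nonneg _
  have hL₀₁ : L₀ ≤ L₁ := le_abs_self _
  set L := L₁ + 2 * |M| + 2 * |B| + 3 * c
  have hM := le_abs_self M
  have hB := le_abs_self B
  have hM' := abs_nonneg M
  have hB' := abs_nonneg B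
  refine ⟨L, by positivity, fun N hN w n g p m m' => ?_⟩
  set α := min (dist x (g • x)) (dist x (g • h ^ p • x))
  set β := max (dist x (g • x)) (dist x (g • h ^ p • x))
  have hα : 0 ≤ α := le_min dist_nonneg dist_nonneg
  have e0 : axisWord h t N 0 • x = x := one_smul _ _
  have hend : β - L ≤ wordCoord h t x N n := by
    have key : ∀ z, gromovProduct z x (axisWord h t N n • x) ≤ M →
        dist x z ≤ wordCoord h t x N n + 2 * M := by
      intro z hz
      have := dist_nonneg (x := axisWord h t N n • x) (y := z)
      simp only [gromovProduct, wordCoord] at *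
      linarith
    have : β ≤ wordCoord h t x N n + 2 * M := max_le (key _ m) (key _ m')
    linarith
  refine ⟨hend, fun j hj => ?_⟩
  by_contra! hcon
  obtain ⟨hlow, hup⟩ := hcon
  have hj0 : j ≠ 0 := by
    rintro rfl
    rw [wordCoord, e0, dist_self] at hlow
    linarith
  have hjn : j ≠ n := by
    rintro rfl; linarith
  obtain ⟨i, rfl⟩ := Nat.exists_eq_succ_of_ne_zero hj0
  rw [Nat.succ_eq_add_one] at *
  have hnear : ∀ j ≤ n, gromovProduct (axisWord h t N j • x) x (axisWord h t N n • x) ≤ B := by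
    intro j hj
    have := w.near 0 j n (by omega) hj
    rwa [e0] at this
  have hseg : ∀ j, j + 1 ≤ n → ∀ s s', s ≤ wordCoord h t x N (j + 1) - c →
      s' ≤ wordCoord h t x N (j + 1) - c → wordCoord h t x N j ≤ s → wordCoord h t x N j ≤ s' →
      α ≤ s → s ≤ β → α ≤ s' → s' ≤ β → L₁ ≤ |s - s'| →
      (axisWord h t N j)⁻¹ * g ∈ axisStabilizer h x := by
    intro j hj s s' h1 h2 h3 h4 h5 h6 h7 h8 h9
    have t1 := dist_triangle x (axisWord h t N j • h ^ (wordExp j * N) • x)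
      (axisWord h t N (j + 1) • x)
    have t2 := w.piece j
    have t3 : wordCoord h t x N (j + 1) - c ≤
        dist x (axisWord h t N j • h ^ (wordExp j * N) • x) := by
      simp only [wordCoord]; linarith
    refine hL₀ x (axisWord h t N n • x) (axisWord h t N j) g (wordExp j * N) p
      (le_max_of_le_right ((hnear j (by omega)).trans (by linarith)))
      (le_max_of_le_right (gromovProduct_le_of_close (hnear (j + 1) hj) t2))
      (le_max_of_le_left m) (le_max_of_le_left m') s s' ?_ ?_ ?_ ?_ (hL₀₁.trans h9)
    · exact Set.mem_uIcc.2 (Or.inl ⟨h3, h1.trans t3⟩)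
    · exact Set.mem_uIcc.2 (Or.inl ⟨h4, h2.trans t3⟩)
    · exact ⟨h5, h6⟩
    · exact ⟨h7, h8⟩
  have hgap : ∀ j, wordCoord h t x N j + L - c - 2 * B ≤ wordCoord h t x N (j + 1) := by
    intro j
    have h1 := (w.wordCoord_succ j).1
    have h2 : 1 * dist x (h ^ N • x) ≤ |(wordExp j : ℝ)| * dist x (h ^ N • x) :=
      mul_le_mul_of_nonneg_right (one_le_abs_wordExp j) dist_nonneg
    linarith
  have g1 := hgap i
  have g2 := hgap (i + 1)
  -- A turn well inside the segment leaves an overlap of length `L₁` with the piece before it and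
  -- with the piece after it. Both pieces are then coarsely on the axis translated by `g`, so the
  -- letter between them lies in the stabilizer.
  have mem1 := hseg i hj (wordCoord h t x N (i + 1) - c) (wordCoord h t x N (i + 1) - c - L₁)
    le_rfl (by linarith) (by linarith) (by linarith) (by linarith) (by linarith) (by linarith)
    (by linarith) (by rw [sub_sub_cancel]; exact le_abs_self _)
  have mem2 := hseg (i + 1) (by omega) (wordCoord h t x N (i + 1) + L₁) (wordCoord h t x N (i + 1))
    (by linarith) (by linarith) (by linarith) (by linarith) (by linarith) (by linarith)
    (by linarith) (by linarith) (by rw [add_sub_cancel_left]; exact le_abs_self _)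
  have := mul_mem mem1 (inv_mem mem2)
  rw [axisWord] at this
  refine axisLetter_notMem ht N i ?_
  convert this using 1
  group

end WordAxis

/-! ## Translates of one period of a word axis along another word axis -/

section Copies

variable {Γ : Type*} [Group Γ] {X : Type*} [MetricSpace X] [MulAction Γ X] [IsIsometricSMul Γ X]

theorem IsWordAxis.near_of_near {δ : ℝ} (hδ : IsHyperbolicWith X δ) {h t : Γ} {x : X} {B c : ℝ}
    {N : ℕ} (w : IsWordAxis h t x B c N) {M : ℝ} {g : Γ} {o y : X}
    (m : gromovProduct (g • x) o y ≤ M) (m' : gromovProduct (g • periodWord h t N • x) o y ≤ M)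
    {j : ℕ} (hj : j ≤ 4) :
    gromovProduct (g • axisWord h t N j • x) o y ≤ M + 2 * B + 2 * δ := by
  refine hδ.near_of_near m m' ?_
  have := w.near 0 j 4 (by omega) hj
  rw [← gromovProduct_smul_smul g] at this
  rwa [show axisWord h t N 0 • x = x from one_smul _ _] at this

theorem IsWordAxis.near_piece_of_near {δ : ℝ} (hδ : IsHyperbolicWith X δ) {h t : Γ} {x : X}
    {B c : ℝ} {N : ℕ} (w : IsWordAxis h t x B c N) {M : ℝ} {g : Γ} {o y : X}
    (m : gromovProduct (g • x) o y ≤ M) (m' : gromovProduct (g • periodWord h t N • x) o y ≤ M)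
    {j : ℕ} (hj : j < 4) :
    gromovProduct ((g * axisWord h t N j) • h ^ (wordExp j * N) • x) o y ≤
      M + 2 * B + 2 * δ + c := by
  refine gromovProduct_le_of_close (w.near_of_near hδ m m' (j := j + 1) hj) ?_
  rw [mul_smul, dist_smul]
  exact w.piece j

/-- A period of a word axis with long pieces does not run along a word axis with shorter
pieces. -/
theorem IsQuasiAxis.exists_no_longer_copy {δ : ℝ} (hδ : IsHyperbolicWith X δ) {h : Γ}
    {x : X} {K C : ℝ} (H : IsQuasiAxis h x K C) (hov : HasBoundedOverlaps h x) {t : Γ}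
    (ht : t ∉ axisStabilizer h x) {B c : ℝ} (hc : 0 ≤ c) (M : ℝ) :
    ∃ Δ : ℝ, ∀ N N' : ℕ, IsWordAxis h t x B c N → IsWordAxis h t x B c N' →
      Δ ≤ dist x (h ^ N • x) → dist x (h ^ N • x) + Δ ≤ dist x (h ^ N' • x) →
      ∀ (n : ℕ) (g : Γ), gromovProduct (g • x) x (axisWord h t N n • x) ≤ M →
        gromovProduct (g • periodWord h t N' • x) x (axisWord h t N n • x) ≤ M → False := by
  set M' := M + 2 * B + 2 * δ + c
  obtain ⟨L, hL0, hL⟩ := H.exists_no_turn_inside hδ hov ht (B := B) hc M'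
  refine ⟨L + 14 * C + 2 * |M'| + 2 * |δ| + 2 * L + c + 1, fun N N' w w' hN hN' n g m m' => ?_⟩
  have hC := H.nonneg
  have hM := le_abs_self M'
  have hM' := abs_nonneg M'
  have hδ' := le_abs_self δ
  have hδ'' := abs_nonneg δ
  -- The piece with exponent `-7 * N'` is longer than every piece for `N`, so it would have to
  -- contain a turn.
  have m1 := w'.near_of_near hδ m m' (j := 2) (by norm_num)
  have m2 := w'.near_piece_of_near hδ m m' (j := 2) (by norm_num)
  rw [← mul_smul] at m1
  obtain ⟨hend, hbr⟩ := hL N (by linarith) w n (g * axisWord h t N' 2) (wordExp 2 * N')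
    (m1.trans (by linarith)) m2
  set P := dist x ((g * axisWord h t N' 2) • x)
  set Q := dist x ((g * axisWord h t N' 2) • h ^ (wordExp 2 * N') • x)
  have e2 : wordExp 2 = -7 := rfl
  have len : 7 * dist x (h ^ N' • x) - 14 * C - 2 * M' - 2 * δ ≤ max P Q - min P Q := by
    have h1 := hδ.dist_le_of_near (m1.trans (by linarith : _ ≤ M')) m2
    have h2 := abs_le.1 (H.abs_dist_wordExp_sub_le N' 2)
    rw [dist_smul] at h1
    have e3 : |((wordExp 2 : ℤ) : ℝ)| = 7 := by rw [e2]; norm_num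
    rw [e3] at h2
    rw [max_sub_min_eq_abs, abs_sub_comm]
    linarith
  obtain ⟨j, hj, hj1, hj2⟩ := exists_le_lt_succ (s := wordCoord h t x N) (θ := min P Q + L) (n := n)
    (by
      have : wordCoord h t x N 0 = 0 := by simp [wordCoord, axisWord]
      have : 0 ≤ min P Q := le_min dist_nonneg dist_nonneg
      linarith)
    (by linarith [dist_nonneg (x := x) (y := h ^ N • x)])
  have h3 := (w.wordCoord_succ j).2
  have h4 : |(wordExp j : ℝ)| * dist x (h ^ N • x) ≤ 7 * dist x (h ^ N • x) := by
    refine mul_le_mul_of_nonneg_right ?_ dist_nonneg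
    simp only [wordExp]
    split_ifs <;> norm_num
  rcases hbr (j + 1) hj with h5 | h5
  · linarith
  · linarith [dist_nonneg (x := x) (y := h ^ N • x)]

/-- The word axis contains no long reversed copy of its period. -/
theorem IsQuasiAxis.exists_no_reversed_copy {δ : ℝ} (hδ : IsHyperbolicWith X δ) {h : Γ}
    {x : X} {K C : ℝ} (H : IsQuasiAxis h x K C) (hov : HasBoundedOverlaps h x) {t : Γ}
    (ht : t ∉ axisStabilizer h x) {B c : ℝ} (hB : 0 ≤ B) (hc : 0 ≤ c) (M : ℝ) :
    ∃ Δ : ℝ, ∀ N : ℕ, IsWordAxis h t x B c N → Δ ≤ dist x (h ^ N • x) →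
      ∀ (k : ℕ) (g : Γ), gromovProduct (g • x) x (axisWord h t N (4 * k) • x) ≤ M →
        gromovProduct (g • periodWord h t N • x) x (axisWord h t N (4 * k) • x) ≤ M →
        gromovProduct (g • x) (axisWord h t N (4 * k) • x) (g • periodWord h t N • x) ≤ M →
        False := by
  set M' := M + 2 * B + 2 * |δ| + c
  obtain ⟨L, hL0, hL⟩ := H.exists_no_turn_inside hδ hov ht (B := B) hc M'
  refine ⟨4 * L + 12 * |M| + 24 * B + 10 * c + 1, fun N w hN k g m m' hor => ?_⟩
  have hδ' := le_abs_self δ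
  have hM := le_abs_self M
  have hM' := abs_nonneg M
  set Λ := dist x (h ^ N • x)
  set y := axisWord h t N (4 * k) • x with hy
  set a := fun j => g • axisWord h t N j • x with ha
  have a0 : a 0 = g • x := by simp [ha, axisWord]
  have a4 : a 4 = g • periodWord h t N • x := rfl
  have dstep : ∀ j, |dist (a j) (a (j + 1)) - |(wordExp j : ℝ)| * Λ| ≤ c := by
    intro j; simp only [ha, dist_smul]; exact w.step j
  have d1 := abs_le.1 (dstep 1)
  have d2 := abs_le.1 (dstep 2)
  have e1 : |((wordExp 1 : ℤ) : ℝ)| = 4 := by norm_num [wordExp]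
  have e2 : |((wordExp 2 : ℤ) : ℝ)| = 7 := by norm_num [wordExp]
  rw [e1] at d1
  rw [e2] at d2
  have near : ∀ i j l, i ≤ j → j ≤ l → gromovProduct (a j) (a i) (a l) ≤ B := by
    intro i j l hij hjl
    simp only [ha, gromovProduct_smul_smul]
    exact w.near i j l hij hjl
  have dsum : dist (a 0) (a 1) + dist (a 1) (a 2) + dist (a 2) (a 3) + dist (a 3) (a 4) - 6 * B ≤
      dist (a 0) (a 4) := by
    have n1 := near 0 1 2 (by norm_num) (by norm_num)
    have n2 := near 0 2 3 (by norm_num) (by norm_num)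
    have n3 := near 0 3 4 (by norm_num) (by norm_num)
    simp only [gromovProduct, dist_comm (a 2) (a 1), dist_comm (a 3) (a 2),
      dist_comm (a 4) (a 3)] at n1 n2 n3
    linarith
  -- The copy runs towards `x`, while the word axis runs away from `x`. As almost no length is lost
  -- in total, each piece of the copy runs backwards.
  have hdir : dist (a 0) (a 4) - 4 * M ≤ dist x (a 0) - dist x (a 4) := by
    rw [← a0] at m hor
    rw [← a4] at m' hor
    have := gromovProduct_nonneg (a 0) x y
    simp only [gromovProduct, dist_comm (a 4) (a 0), dist_comm y (a 0), dist_comm y (a 4)] at *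
    have t1 := dist_triangle x (a 0) y
    have t2 := dist_triangle x (a 4) y
    linarith
  have t01 := dist_triangle_right x (a 0) (a 1)
  have t12 := dist_triangle_right x (a 1) (a 2)
  have t23 := dist_triangle_right x (a 2) (a 3)
  have t34 := dist_triangle_right x (a 3) (a 4)
  set s := fun j => dist x (a j) with hs
  have s12 : 4 * Λ - c - 4 * M - 6 * B ≤ s 1 - s 2 := by simp only [hs]; linarith
  have s23 : 7 * Λ - c - 4 * M - 6 * B ≤ s 2 - s 3 := by simp only [hs]; linarith
  have s12' : s 1 ≤ s 2 + 4 * Λ + c := by simp only [hs]; linarith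
  have s23' : s 2 ≤ s 3 + 7 * Λ + c := by simp only [hs]; linarith
  have win : ∀ j, j < 4 → ∃ b : ℝ, 0 ≤ b ∧ |b - s (j + 1)| ≤ c ∧
      max (s j) b - L ≤ wordCoord h t x N (4 * k) ∧ ∀ l ≤ 4 * k,
        wordCoord h t x N l ≤ min (s j) b + L ∨ max (s j) b - L ≤ wordCoord h t x N l := by
    intro j hj
    have n1 := w.near_of_near hδ m m' (j := j) hj.le
    have n2 := w.near_piece_of_near hδ m m' hj
    rw [← mul_smul] at n1
    have := hL N (by linarith) w (4 * k) (g * axisWord h t N j) (wordExp j * N)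
      (n1.trans (by linarith)) (n2.trans (by linarith))
    refine ⟨dist x ((g * axisWord h t N j) • h ^ (wordExp j * N) • x), dist_nonneg, ?_, ?_⟩
    · have h1 := abs_dist_sub_le ((g * axisWord h t N j) • h ^ (wordExp j * N) • x) (a (j + 1)) x
      rw [dist_comm _ x, dist_comm _ x] at h1
      refine h1.trans ?_
      rw [mul_smul, dist_smul]
      exact w.piece j
    · simpa only [hs, ha, ← mul_smul] using this
  obtain ⟨b, -, hb, hend, hbr⟩ := win 1 (by norm_num)
  obtain ⟨b', hb0, hb', -, hbr'⟩ := win 2 (by norm_num)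
  obtain ⟨hb1, hb2⟩ := abs_le.1 hb
  obtain ⟨hb1', hb2'⟩ := abs_le.1 hb'
  simp only [Nat.reduceAdd] at hb1 hb2 hb1' hb2'
  rw [min_eq_right (by linarith), max_eq_left (by linarith)] at hbr
  rw [min_eq_right (by linarith), max_eq_left (by linarith)] at hbr'
  rw [max_eq_left (by linarith)] at hend
  obtain ⟨j, hj, hj1, hj2⟩ := exists_le_lt_succ (s := wordCoord h t x N) (θ := b' + L)
    (n := 4 * k) (by rw [wordCoord]; simp [axisWord]; linarith) (by linarith)
  have c1 := w.wordCoord_succ j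
  have h5 : s 2 - L ≤ wordCoord h t x N (j + 1) := by
    rcases hbr' (j + 1) hj with h5 | h5
    · linarith
    · exact h5
  -- Piece `j` of the axis covers most of the copy of the longest piece, so it is itself a longest
  -- piece.
  have hexp : j % 4 = 2 := by
    by_contra hne
    have h4 : |(wordExp j : ℝ)| * Λ ≤ 4 * Λ := by
      refine mul_le_mul_of_nonneg_right ?_ dist_nonneg
      simp only [wordExp, if_neg hne]
      split_ifs <;> norm_num
    linarith
  have ej : |(wordExp j : ℝ)| = 7 := by simp [wordExp, hexp]
  have ej' : |(wordExp (j + 1) : ℝ)| = 2 := by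
    have h1 : (j + 1) % 4 = 3 := by omega
    simp [wordExp, h1]
  have c2 := w.wordCoord_succ (j + 1)
  rw [ej] at c1
  rw [ej'] at c2
  -- After its longest piece the axis has a piece of length about `2 * Λ`, whereas the reversed copy
  -- has one of about `4 * Λ`; vertex `j + 2` is a turn inside the latter. It exists because the
  -- axis is cut at a multiple of 4.
  rcases hbr (j + 2) (by omega) with h6 | h6 <;> linarith

end Copies

/-! ## A family of quasimorphisms -/

section Quasimorphisms

variable {Γ : Type*} [Group Γ]

/-- Uniform quasimorphisms `f n` and elements `u n` such that `f n` is unbounded on the powers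
of `u n`, on which the later quasimorphisms are bounded. -/
structure IsTriangularFamily (f : ℕ → Γ → ℝ) (u : ℕ → Γ) (D : ℝ) : Prop where
  defect : ∀ n g h, |f n g + f n h - f n (g * h)| ≤ D
  eventually_zero : ∀ g, ∃ n₀, ∀ n ≥ n₀, f n g = 0
  growth : ∀ n (k : ℕ), f n (u n ^ k) ≤ -k + 1
  bounded : ∀ n m (k : ℕ), n < m → |f m (u n ^ k)| ≤ 1
  map_eq_zero : ∀ n (φ : Γ → ℝ), (∀ a b, φ (a * b) = φ a + φ b) → φ (u n) = 0

variable {X : Type*} [MetricSpace X] [MulAction Γ X]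

/-- The translates of the pair `(x, u • x)`. -/
def translatePairs (x : X) (u : Γ) : Set (X × X) :=
  Set.range fun g : Γ => (g • x, g • u • x)

omit [MetricSpace X] in
theorem smul_mem_translatePairs {x : X} {u : Γ} (g : Γ) {p : X × X} (hp : p ∈ translatePairs x u) :
    g • p ∈ translatePairs x u := by
  obtain ⟨k, rfl⟩ := hp
  exact ⟨g * k, by simp [mul_smul]⟩

variable [IsIsometricSMul Γ X]

theorem dist_of_mem_translatePairs {x : X} {u : Γ} {p : X × X} (hp : p ∈ translatePairs x u) :
    dist p.1 p.2 = dist x (u • x) := by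
  obtain ⟨k, rfl⟩ := hp
  exact dist_smul _ _ _

theorem shortcutDist_pow_smul_le {W : ℝ} {x : X} {u : Γ}
    (hQ : LongShortcuts W (translatePairs x u)) (k : ℕ) :
    shortcutDist W (translatePairs x u) x (u ^ k • x) ≤ k * (dist x (u • x) - W) := by
  induction k with
  | zero => simpa using shortcutDist_le_dist hQ x x
  | succ k ih =>
    have h1 := shortcutDist_triangle hQ x (u ^ k • x) (u ^ k • u • x)
    rw [shortcutDist_smul hQ (fun g p hp => smul_mem_translatePairs g hp) (u ^ k)] at h1
    have h2 := shortcutDist_le_of_mem hQ (p := (x, u • x)) ⟨1, by simp⟩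
    rw [← mul_smul, ← pow_succ] at h1
    push_cast
    simp only at h2
    linarith

theorem IsWordAxis.le_dist_pow {h t : Γ} {x : X} {B c : ℝ} {N : ℕ} (w : IsWordAxis h t x B c N)
    (k : ℕ) : k * (dist x (periodWord h t N • x) - 2 * B) ≤
      dist x (periodWord h t N ^ k • x) := by
  induction k with
  | zero => simp
  | succ k ih =>
    have h1 := w.near 0 (4 * k) (4 * (k + 1)) (by omega) (by omega)
    rw [axisWord_four_mul, axisWord_four_mul, show axisWord h t N 0 • x = x from one_smul _ _] at h1
    have h2 : dist (periodWord h t N ^ k • x) (periodWord h t N ^ (k + 1) • x) =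
        dist x (periodWord h t N • x) := by
      rw [pow_succ, mul_smul, dist_smul]
    simp only [gromovProduct] at h1
    rw [dist_comm (periodWord h t N ^ (k + 1) • x), h2] at h1
    push_cast
    linarith

omit [IsIsometricSMul Γ X] in
theorem IsWordAxis.le_dist_periodWord {h t : Γ} {x : X} {B c : ℝ} {N : ℕ}
    (w : IsWordAxis h t x B c N) (hN : c + 2 * B ≤ dist x (h ^ N • x)) :
    dist x (h ^ N • x) - c - 2 * B ≤ dist x (periodWord h t N • x) := by
  have key : ∀ j, wordCoord h t x N j + dist x (h ^ N • x) - c - 2 * B ≤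
      wordCoord h t x N (j + 1) := by
    intro j
    have h1 := (w.wordCoord_succ j).1
    have h2 : 1 * dist x (h ^ N • x) ≤ |(wordExp j : ℝ)| * dist x (h ^ N • x) :=
      mul_le_mul_of_nonneg_right (one_le_abs_wordExp j) dist_nonneg
    linarith
  have h0 : wordCoord h t x N 0 = 0 := by simp [wordCoord, axisWord]
  have h1 := key 0
  have h2 := key 1
  have h3 := key 2
  have h4 : _ ≤ dist x (periodWord h t N • x) := key 3
  simp only [Nat.reduceAdd] at *
  linarith

/-- Along the powers of `u n` every period offers a shortcut forwards and none helps backwards,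
whence the growth. Shortcuts for a later `u m` fit in neither direction. For fixed `g` the shortcuts
eventually are too long to be of use. -/
theorem exists_isTriangularFamily [Nonempty X] [GeodesicMetricSpace X] [GromovHyperbolicSpace X]
    (hind : ∃ g h : Γ, IndependentLoxodromics X g h) (hwwpd : ∃ γ : Γ, IsWWPD X γ) :
    ∃ (f : ℕ → Γ → ℝ) (u : ℕ → Γ) (D : ℝ), IsTriangularFamily f u D := by
  obtain ⟨δ, h1, hδ⟩ := exists_isHyperbolicWith X
  have h0 : 0 ≤ δ := by linarith
  obtain ⟨x⟩ := ‹Nonempty X›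
  obtain ⟨h, hh⟩ := hwwpd
  obtain ⟨K, C, H⟩ := hh.1.exists_isQuasiAxis h1 hδ x
  have hov : HasBoundedOverlaps h x := fun R => hh.exists_mem_axisStabilizer_of_overlap h0 hδ H R
  obtain ⟨g₁, g₂, hg⟩ := hind
  obtain ⟨t, ht⟩ := hg.exists_notMem_axisStabilizer h1 hδ H
  obtain ⟨B, c, Λ₀, hB, hc, hw⟩ := H.exists_isWordAxis h1 hδ hov ht
  -- Concatenating periods loses at most `2 * B` of length per period, so each shortcut has a net
  -- gain of at least 1.
  set W := 2 * B + 1 with hWdef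
  have hW : 1 ≤ W := by linarith
  obtain ⟨M, hM0, hM⟩ := exists_shortcut_near h1 hδ hW
  obtain ⟨D, hD0, hD⟩ := exists_shortcutForm_cocycle_bound h1 hδ hW
  obtain ⟨Δ₁, hΔ₁⟩ := H.exists_no_longer_copy hδ hov ht hc M (B := B)
  obtain ⟨Δ₂, hΔ₂⟩ := H.exists_no_reversed_copy hδ hov ht hB hc M
  have hlarge : ∀ v : ℝ, ∃ N : ℕ, v ≤ dist x (h ^ N • x) := by
    intro v
    have hK : 0 < K := by linarith [H.one_le]
    obtain ⟨N, hN⟩ := exists_nat_ge ((v + C) * K)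
    rw [← le_div_iff₀ hK] at hN
    have := H.lower 0 N
    simp only [Int.cast_zero, Int.cast_natCast, zero_sub, abs_neg, Nat.abs_cast, zpow_zero, one_smul,
      zpow_natCast] at this
    exact ⟨N, by linarith⟩
  choose F hF using hlarge
  set Θ := max (max (max Λ₀ Δ₁) Δ₂) (2 * W + c + 2 * B)
  have hΘ1 : Λ₀ ≤ Θ := (le_max_left _ _).trans ((le_max_left _ _).trans (le_max_left _ _))
  have hΘ2 : Δ₁ ≤ Θ := (le_max_right _ _).trans ((le_max_left _ _).trans (le_max_left _ _))
  have hΘ3 : Δ₂ ≤ Θ := (le_max_right _ _).trans (le_max_left _ _)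
  have hΘ4 : 2 * W + c + 2 * B ≤ Θ := le_max_right _ _
  -- Successive piece lengths differ by at least `Θ`, so that no later period fits along an earlier
  -- axis and the lengths tend to infinity.
  let N : ℕ → ℕ := fun n => Nat.rec (F Θ) (fun _ k => F (dist x (h ^ k • x) + Θ)) n
  set Λ := fun n => dist x (h ^ N n • x) with hΛ
  have hΛ0 : Θ ≤ Λ 0 := hF Θ
  have hΛs : ∀ n, Λ n + Θ ≤ Λ (n + 1) := fun n => hF (Λ n + Θ)
  have hΛlt : ∀ n m, n < m → Λ n + Θ ≤ Λ m := by
    intro n m hnm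
    induction m, hnm using Nat.le_induction with
    | base => exact hΛs n
    | succ m _ ih => linarith [hΛs m]
  have hΛn : ∀ n : ℕ, n + Θ ≤ Λ n := by
    intro n
    induction n with
    | zero => simpa using hΛ0
    | succ n ih => push_cast; linarith [hΛs n]
  have hΛΘ : ∀ n, Θ ≤ Λ n := fun n => by linarith [hΛn n, (Nat.cast_nonneg n : (0 : ℝ) ≤ n)]
  have w : ∀ n, IsWordAxis h t x B c (N n) := fun n => hw _ (hΘ1.trans (hΛΘ n))
  set u := fun n => periodWord h t (N n)
  have hlen : ∀ n, Λ n - c - 2 * B ≤ dist x (u n • x) := fun n =>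
    (w n).le_dist_periodWord (le_trans (by linarith) (hΛΘ n))
  have hQ : ∀ n, LongShortcuts W (translatePairs x (u n)) := by
    intro n p hp
    rw [dist_of_mem_translatePairs hp]
    linarith [hlen n, hΛΘ n]
  have hpow : ∀ n k : ℕ, u n ^ k • x = axisWord h t (N n) (4 * k) • x := fun n k => by
    rw [axisWord_four_mul]
  refine ⟨fun n g => shortcutForm W (translatePairs x (u n)) x (g • x), u, D,
    ⟨fun n g k => ?_, fun g => ?_, fun n k => ?_, fun n m k hnm => ?_,
      fun n φ hφ => map_periodWord hφ h t (N n)⟩⟩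
  · have e : shortcutForm W (translatePairs x (u n)) x (k • x) =
        shortcutForm W (translatePairs x (u n)) (g • x) ((g * k) • x) := by
      rw [mul_smul]
      simp only [shortcutForm, shortcutDist_smul (hQ n) (fun g p hp => smul_mem_translatePairs g hp)]
    rw [e]
    exact hD _ (hQ n) x (g • x) ((g * k) • x)
  · obtain ⟨n₀, hn₀⟩ := exists_nat_ge (dist x (g • x))
    refine ⟨n₀, fun n hn => shortcutForm_of_forall_dist_le (hQ n) fun p hp => ?_⟩
    rw [dist_of_mem_translatePairs hp]
    have : (n₀ : ℝ) ≤ n := by exact_mod_cast hn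
    linarith [hlen n, hΛn n]
  · have e1 := shortcutDist_pow_smul_le (hQ n) k
    have e2 : dist (u n ^ k • x) x - 1 ≤
        shortcutDist W (translatePairs x (u n)) (u n ^ k • x) x := by
      rcases hM _ (hQ n) (u n ^ k • x) x with h2 | ⟨p, ⟨g, rfl⟩, h3, h4, h5⟩
      · exact h2
      · simp only [hpow] at h3 h4 h5
        rw [gromovProduct_comm] at h3 h4
        exact (hΔ₂ (N n) (w n) (hΘ3.trans (hΛΘ n)) k g h3 h4 h5).elim
    have e3 := (w n).le_dist_pow k
    rw [dist_comm] at e2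
    have e4 : (k : ℝ) * (dist x (u n • x) - W) =
      k * (dist x (u n • x) - 2 * B) - k := by rw [hWdef]; ring
    change k * (dist x (u n • x) - 2 * B) ≤ dist x (u n ^ k • x) at e3
    simp only [shortcutForm]
    linarith
  · have key : ∀ g : Γ, gromovProduct (g • x) x (u n ^ k • x) ≤ M →
        gromovProduct (g • u m • x) x (u n ^ k • x) ≤ M → False := by
      intro g a1 a2
      rw [hpow] at a1 a2
      exact hΔ₁ (N n) (N m) (w n) (w m) (hΘ2.trans (hΛΘ n))
        (le_trans (by linarith) (hΛlt n m hnm)) (4 * k) g a1 a2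
    have e1 : dist x (u n ^ k • x) - 1 ≤
        shortcutDist W (translatePairs x (u m)) x (u n ^ k • x) := by
      rcases hM _ (hQ m) x (u n ^ k • x) with h2 | ⟨p, ⟨g, rfl⟩, h3, h4, -⟩
      · exact h2
      · exact (key g h3 h4).elim
    have e2 : dist (u n ^ k • x) x - 1 ≤
        shortcutDist W (translatePairs x (u m)) (u n ^ k • x) x := by
      rcases hM _ (hQ m) (u n ^ k • x) x with h2 | ⟨p, ⟨g, rfl⟩, h3, h4, -⟩
      · exact h2
      · rw [gromovProduct_comm] at h3 h4
        exact (key g h3 h4).elim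
    have e3 := shortcutDist_le_dist (hQ m) x (u n ^ k • x)
    have e4 := shortcutDist_le_dist (hQ m) (u n ^ k • x) x
    rw [dist_comm] at e2 e4
    simp only [shortcutForm]
    rw [abs_le]
    constructor <;> linarith

end Quasimorphisms

/-! ## The embedding of `ℓ¹` -/

section Embedding

theorem lp_one_summable_abs (a : lp (fun _ : ℕ => ℝ) 1) : Summable fun n => |a n| := by
  have := (lp.memℓp a).summable (by norm_num)
  simpa using this

theorem lp_one_norm_eq (a : lp (fun _ : ℕ => ℝ) 1) : ‖a‖ = ∑' n, |a n| := by
  rw [lp.norm_eq_tsum_rpow (by norm_num)]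
  simp

variable {ι : Type*} {D : ℝ} {c : ℕ → ι → ℝ}

theorem summable_lp_one_mul (hc : ∀ n p, |c n p| ≤ D) (a : lp (fun _ : ℕ => ℝ) 1) (p : ι) :
    Summable fun n => a n * c n p := by
  refine Summable.of_norm_bounded ((lp_one_summable_abs a).mul_right D) fun n => ?_
  rw [Real.norm_eq_abs, abs_mul]
  exact mul_le_mul_of_nonneg_left (hc n p) (abs_nonneg _)

theorem abs_tsum_lp_one_mul_le (hc : ∀ n p, |c n p| ≤ D) (a : lp (fun _ : ℕ => ℝ) 1) (p : ι) :
    |∑' n, a n * c n p| ≤ D * ‖a‖ := by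
  have h := tsum_of_norm_bounded (f := fun n => a n * c n p)
    ((lp_one_summable_abs a).mul_right D).hasSum fun n => by
      rw [Real.norm_eq_abs, abs_mul]
      exact mul_le_mul_of_nonneg_left (hc n p) (abs_nonneg _)
  rwa [tsum_mul_right, ← lp_one_norm_eq, mul_comm, Real.norm_eq_abs] at h

/-- The continuous linear map `a ↦ ∑ a n • c n` for uniformly bounded functions `c n`. -/
noncomputable def lpOneCombination (hD : 0 ≤ D) (hc : ∀ n p, |c n p| ≤ D) :
    lp (fun _ : ℕ => ℝ) 1 →L[ℝ] lp (fun _ : ι => ℝ) ∞ :=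
  LinearMap.mkContinuous
    { toFun := fun a => ⟨fun p => ∑' n, a n * c n p, memℓp_infty ⟨D * ‖a‖, by
        rintro _ ⟨p, rfl⟩
        exact abs_tsum_lp_one_mul_le hc a p⟩⟩
      map_add' := by
        intro a b
        ext p
        simp only [lp.coeFn_add, Pi.add_apply, add_mul]
        exact (summable_lp_one_mul hc a p).tsum_add (summable_lp_one_mul hc b p)
      map_smul' := by
        intro r a
        ext p
        simp only [lp.coeFn_smul, Pi.smul_apply, smul_eq_mul, mul_assoc, RingHom.id_apply]
        exact tsum_mul_left } D fun a =>
    lp.norm_le_of_forall_le (by positivity) fun p => abs_tsum_lp_one_mul_le hc a p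

theorem lpOneCombination_apply (hD : 0 ≤ D) (hc : ∀ n p, |c n p| ≤ D)
    (a : lp (fun _ : ℕ => ℝ) 1) (p : ι) : lpOneCombination hD hc a p = ∑' n, a n * c n p :=
  rfl

variable {Γ : Type*} [Group Γ]

/-- `φ`, the difference of `∑ a n • f n` (a finite sum at each group element) and `b`, is a
homomorphism and so vanishes on the powers of `u n`. For the least `n` with `a n ≠ 0`, the later
terms contribute at most `‖a‖` and `b` at most `‖b‖`, so `a n * f n (u n ^ k)` would be bounded in
`k`. -/
theorem IsTriangularFamily.eq_zero_of_tsum_eq {f : ℕ → Γ → ℝ} {u : ℕ → Γ}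
    (hf : IsTriangularFamily f u D) (a : lp (fun _ : ℕ => ℝ) 1) (b : BoundedOneCochain Γ)
    (hb : ∀ g h : Γ, ∑' n, a n * (f n g + f n h - f n (g * h)) = b g + b h - b (g * h)) :
    a = 0 := by
  have hs : ∀ g, Summable fun n => a n * f n g := by
    intro g
    obtain ⟨n₀, hn₀⟩ := hf.eventually_zero g
    refine summable_of_ne_finset_zero (s := Finset.range n₀) fun n hn => ?_
    rw [hn₀ n (by simpa using hn), mul_zero]
  set φ : Γ → ℝ := fun g => ∑' n, a n * f n g - b g
  have hφ : ∀ g h, φ (g * h) = φ g + φ h := by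
    intro g h
    have h1 := hb g h
    simp only [mul_sub, mul_add] at h1
    rw [((hs g).add (hs h)).tsum_sub (hs (g * h)), (hs g).tsum_add (hs h)] at h1
    simp only [φ]
    linarith
  have hpow : ∀ n k : ℕ, φ (u n ^ k) = 0 := by
    intro n k
    induction k with
    | zero => have := hφ 1 1; simp at this; simpa using this
    | succ k ih => rw [pow_succ, hφ, ih, hf.map_eq_zero n φ hφ, add_zero]
  by_contra hne
  have hex : ∃ n, a n ≠ 0 := by
    by_contra! hall
    exact hne (lp.ext (funext hall))
  classical
  set n := Nat.find hex
  have hn : a n ≠ 0 := Nat.find_spec hex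
  have hmin : ∀ m < n, a m = 0 := fun m hm => not_not.1 (Nat.find_min hex hm)
  obtain ⟨k, hk⟩ := exists_nat_gt ((‖b‖ + ‖a‖) / |a n| + 1)
  have h1 := hpow n k
  simp only [φ, (hs (u n ^ k)).tsum_eq_add_tsum_ite n] at h1
  have h2 : |∑' m, if m = n then 0 else a m * f m (u n ^ k)| ≤ ‖a‖ := by
    rw [lp_one_norm_eq]
    refine (Real.norm_eq_abs _).symm.trans_le
      (tsum_of_norm_bounded (lp_one_summable_abs a).hasSum fun m => ?_)
    rcases lt_trichotomy m n with hm | rfl | hm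
    · simp [hmin m hm]
    · simp
    · rw [if_neg hm.ne', Real.norm_eq_abs, abs_mul]
      exact mul_le_of_le_one_right (abs_nonneg _) (hf.bounded n m k hm)
  have h3 : |b (u n ^ k)| ≤ ‖b‖ := lp.norm_apply_le_norm (by simp) b _
  have h4 : |a n * f n (u n ^ k)| ≤ ‖b‖ + ‖a‖ := by
    rw [abs_le] at *
    constructor <;> linarith
  have hpos : 0 < |a n| := abs_pos.2 hn
  have h5 : (k : ℝ) - 1 ≤ |f n (u n ^ k)| := by
    have := hf.growth n k
    have := neg_abs_le (f n (u n ^ k))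
    linarith
  rw [abs_mul, mul_comm, ← le_div_iff₀ hpos] at h4
  linarith

/-- The common defect bound makes `a ↦ ∑ a n • δ(f n)` a bounded map into the cocycles, even though
the `f n` themselves are unbounded. -/
theorem IsTriangularFamily.exists_injective {f : ℕ → Γ → ℝ} {u : ℕ → Γ}
    (hf : IsTriangularFamily f u D) :
    ∃ Φ : lp (fun _ : ℕ => ℝ) 1 →L[ℝ] SecondBoundedCohomology Γ, Function.Injective Φ := by
  have hD : 0 ≤ D := (abs_nonneg _).trans (hf.defect 0 1 1)
  set c : ℕ → Γ × Γ → ℝ := fun n p => f n p.1 + f n p.2 - f n (p.1 * p.2)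
  have hc : ∀ n p, |c n p| ≤ D := fun n p => hf.defect n p.1 p.2
  have hcoc : ∀ a, lpOneCombination hD hc a ∈ boundedTwoCocycles Γ := by
    intro a g h k
    have hs := summable_lp_one_mul hc a
    simp only [lpOneCombination_apply]
    rw [← (hs _).tsum_sub (hs _), ← ((hs _).sub (hs _)).tsum_add (hs _),
      ← (((hs _).sub (hs _)).add (hs _)).tsum_sub (hs _)]
    convert tsum_zero with n
    simp only [c, mul_assoc]
    ring
  let T : lp (fun _ : ℕ => ℝ) 1 →L[ℝ] boundedTwoCocycles Γ :=
    (lpOneCombination hD hc).codRestrict _ hcoc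
  let q : boundedTwoCocycles Γ →L[ℝ] SecondBoundedCohomology Γ :=
    ⟨((boundedTwoCoboundaries Γ).submoduleOf (boundedTwoCocycles Γ)).mkQ, continuous_quot_mk⟩
  refine ⟨q.comp T, (injective_iff_map_eq_zero _).2 fun a ha => ?_⟩
  have hmem : T a ∈ (boundedTwoCoboundaries Γ).submoduleOf (boundedTwoCocycles Γ) :=
    (Submodule.Quotient.mk_eq_zero _).1 ha
  obtain ⟨b, hb⟩ := hmem
  exact hf.eq_zero_of_tsum_eq a b hb

end Embedding

theorem mainTheorem7 {Γ : Type*} [Group Γ] {S : Type*} [MetricSpace S] [Nonempty S]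
    [GeodesicMetricSpace S] [GromovHyperbolicSpace S] [MulAction Γ S] [IsIsometricSMul Γ S]
    (hind : ∃ g h : Γ, IndependentLoxodromics S g h)
    (hwwpd : ∃ γ : Γ, IsWWPD S γ) :
    ∃ Φ : lp (fun _ : ℕ => ℝ) 1 →L[ℝ] SecondBoundedCohomology Γ, Function.Injective Φ := by
  obtain ⟨f, u, D, hf⟩ := exists_isTriangularFamily hind hwwpd
  exact hf.exists_injective
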